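/- For $\Delta\in[-\pi,\pi)$ let $$\tilde M(\Delta)=\frac1{\sqrt2}\begin{pmatrix}\cos\Delta&\sin\Delta&-\cos\Delta&\sin\Delta\\ \sin\Delta&\cos\Delta&\sin\Delta&-\cos\Delta\\ \sin\Delta&-\cos\Delta&-\sin\Delta&-\cos\Delta\\ -\cos\Delta&\sin\Delta&-\cos\Delta&-\sin\Delta\end{pmatrix},$$ which is the $4\times4$ Grover matrix when $\Delta=3\pi/4$. Consider the walk on $\mathbb Z$ with states $\Psi:\mathbb Z\to\mathbb C^4$ and time evolution $\tilde U=\tilde S\tilde C$, where $(\tilde C\Psi)(x)=\tilde M(\Delta)\Psi(x)$ and $(\tilde S\Psi)(x)={}^T(\Psi_1(x+1),\Psi_2(x-1),\Psi_3(x+1),\Psi_4(x-1))$, started from $\Psi_0(x)={}^T(\phi_1,\phi_2,\phi_3,\phi_4)\,\delta_0(x)$ with $\phi_1,\dots,\phi_4\in\mathbb C$. Here $\delta_{x_0}(x)=1$ if $x=x_0$ and $0$ otherwise. Write $\Psi_n=\tilde U^n\Psi_0$. **(A)** Let $\Delta\in[-\pi,\pi)$, $\Delta\ne\pm\frac\pi4,\pm\frac{3\pi}4$,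 and $\sum_i|\phi_i|^2=1$. Let $X_n$ be a random variable with $\mathbb P(X_n=x)=\|\Psi_n(x)\|^2$, $x\in\mathbb Z$ (these numbers sum to $1$). Put $$p=\tfrac1{\sqrt2}(\cos\Delta-\sin\Delta),\qquad q=\tfrac1{\sqrt2}(\cos\Delta+\sin\Delta),$$ $$d_0=|\phi_1-\phi_2|^2+|\phi_3-\phi_4|^2,$$ $$d_1=p\left(|\phi_2-\phi_4|^2-|\phi_1-\phi_3|^2\right)+q\left(|\phi_2+\phi_3|^2-|\phi_1+\phi_4|^2\right),$$ $$d_2=pq\left(|\phi_1+\phi_2|^2-|\phi_3+\phi_4|^2\right)+2p^2\,\Re\!\left(\overline{(\phi_1-\phi_4)}(\phi_2-\phi_3)\right)+2q^2\,\Re\!\left(\overline{(\phi_1+\phi_3)}(\phi_2+\phi_4)\right),$$ $$A=1-\frac{d_0}2-\frac{1-\sqrt{1-p^2}}{2p^2}d_2,\qquad f(y)=\frac{\sqrt{1-p^2}}{2\pi p^2\sqrt{p^2-y^2}\,(1-y^2)}\left(p^2d_0+p\,d_1y+d_2y^2\right).$$ Then $A\ge0$, $f\ge0$ on $(-|p|,|p|)$,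 the function $f\,I_{(-|p|,|p|)}$ is integrable, and $A\,\delta_0(dy)+f(y)I_{(-|p|,|p|)}(y)\,dy$ (with $\delta_0(dy)$ the Dirac mass at the origin) is a probability measure, to which $X_n/n$ converges weakly as $n\to\infty$. In terms of distribution functions, for every $x\ne0$, and also for $x=0$ if $A=0$, $$\lim_{n\to\infty}\mathbb P\!\left(\frac{X_n}n\le x\right)=A\,I_{[0,\infty)}(x)+\int_{-\infty}^x f(y)I_{(-|p|,|p|)}(y)\,dy.$$ **(B)** Let $\Delta=\frac\pi4$ (put $j=0$) or $\Delta=-\frac{3\pi}4$ (put $j=1$). For all integers $m\ge0$ and $x$, $$\Psi_{4m}(x)={}^T(\phi_1,\phi_2,\phi_3,\phi_4)\,\delta_0(x),$$ $$\Psi_{4m+1}(x)=\tfrac{(-1)^j}2\,{}^T(\phi_1+\phi_2-\phi_3+\phi_4,\,0,\,\phi_1-\phi_2-\phi_3-\phi_4,\,0)\,\delta_{-1}(x)+\tfrac{(-1)^j}2\,{}^T(0,\,\phi_1+\phi_2+\phi_3-\phi_4,\,0,\,-\phi_1+\phi_2-\phi_3-\phi_4)\,\delta_1(x),$$ $$\Psi_{4m+2}(x)=\tfrac12\,{}^T(\phi_2+\phi_4,0,\phi_2+\phi_4,0)\,\delta_{-2}(x)+\tfrac12\,{}^T(\phi_2-\phi_4,\phi_1-\phi_3,\phi_4-\phi_2,\phi_3-\phi_1)\,\delta_0(x)+\tfrac12\,{}^T(0,\phi_1+\phi_3,0,\phi_1+\phi_3)\,\delta_2(x),$$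 $$\Psi_{4m+3}(x)=\tfrac{(-1)^j}2\,{}^T(\phi_2-\phi_4,\phi_2+\phi_4,\phi_2-\phi_4,-\phi_2-\phi_4)\,\delta_{-1}(x)+\tfrac{(-1)^j}2\,{}^T(\phi_1+\phi_3,\phi_1-\phi_3,-\phi_1-\phi_3,\phi_1-\phi_3)\,\delta_1(x).$$ **(C)** Let $\Delta=-\frac\pi4$ (put $j=0$) or $\Delta=\frac{3\pi}4$ (put $j=1$). For all integers $m\ge0$ and $x$: if $n=2m$, $$\Psi_n(x)={}^T(\phi_1-\phi_3,0,\phi_3-\phi_1,0)\tfrac{\delta_{-n}(x)}2+{}^T(\phi_1+\phi_3,\phi_2+\phi_4,\phi_1+\phi_3,\phi_2+\phi_4)\tfrac{\delta_0(x)}2+{}^T(0,\phi_2-\phi_4,0,\phi_4-\phi_2)\tfrac{\delta_n(x)}2,$$ and if $n=2m+1$, $$\Psi_n(x)=(-1)^j\Big({}^T(\phi_1-\phi_3,0,\phi_3-\phi_1,0)\tfrac{\delta_{-n}(x)}2-{}^T(\phi_2+\phi_4,0,\phi_2+\phi_4,0)\tfrac{\delta_{-1}(x)}2-{}^T(0,\phi_1+\phi_3,0,\phi_1+\phi_3)\tfrac{\delta_1(x)}2+{}^T(0,\phi_2-\phi_4,0,\phi_4-\phi_2)\tfrac{\delta_n(x)}2\Big).$$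 -/

import Mathlib

open MeasureTheory Filter Set Topology

namespace GroverWalk

noncomputable section

/-- The coin matrix of the one-parameter family of 4-state walks. -/
def coinMatrix (Δ : ℝ) : Matrix (Fin 4) (Fin 4) ℝ :=
  (1 / Real.sqrt 2) •
    !![Real.cos Δ, Real.sin Δ, -Real.cos Δ, Real.sin Δ;
       Real.sin Δ, Real.cos Δ, Real.sin Δ, -Real.cos Δ;
       Real.sin Δ, -Real.cos Δ, -Real.sin Δ, -Real.cos Δ;
       -Real.cos Δ, Real.sin Δ, -Real.cos Δ, -Real.sin Δ]

/-- At `Δ = 3π/4` the coin is the Grover matrix. -/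
theorem coinMatrix_grover :
    coinMatrix (3 * Real.pi / 4) =
      (1 / 2 : ℝ) • !![-1, 1, 1, 1; 1, -1, 1, 1; 1, 1, -1, 1; 1, 1, 1, -1] := by
  have h : (3 * Real.pi / 4 : ℝ) = Real.pi - Real.pi / 4 := by ring
  have h2 : (1 / Real.sqrt 2) * (Real.sqrt 2 / 2) = 1 / 2 := by
    field_simp
  have h3 : (Real.sqrt 2)⁻¹ * (Real.sqrt 2 / 2) = 2⁻¹ := by
    simpa using h2
  unfold coinMatrix
  rw [h, Real.cos_pi_sub, Real.sin_pi_sub, Real.cos_pi_div_four, Real.sin_pi_div_four]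
  ext i j
  fin_cases i <;> fin_cases j <;> simp [h3]

/-- Quantum states of a 4-state walk on the integer line. -/
abbrev State : Type := ℤ → Fin 4 → ℂ

/-- The coin operator: the coin matrix acts at every site. -/
def coinOp (Δ : ℝ) (ψ : State) : State :=
  fun x => ((coinMatrix Δ).map (fun r : ℝ => (r : ℂ))).mulVec (ψ x)

/-- The shift operator: components 1 and 3 move to the left, components 2 and 4 to the right. -/
def shiftOp (ψ : State) : State :=
  fun x => ![ψ (x + 1) 0, ψ (x - 1) 1, ψ (x + 1) 2, ψ (x - 1) 3]

/-- The time evolution operator, coin followed by shift. -/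
def evolution (Δ : ℝ) (ψ : State) : State := shiftOp (coinOp Δ ψ)

/-- The function of the position `x` that is `1` at `x₀` and `0` elsewhere. -/
def delta (x₀ x : ℤ) : ℂ := if x = x₀ then 1 else 0

/-- The initial state: the vector `(φ₁, φ₂, φ₃, φ₄)` at the origin, `0` elsewhere. -/
def initialState (φ₁ φ₂ φ₃ φ₄ : ℂ) : State :=
  fun x => delta 0 x • ![φ₁, φ₂, φ₃, φ₄]

/-- The quantum state at time `n`. -/
def stateAt (Δ : ℝ) (φ₁ φ₂ φ₃ φ₄ : ℂ) (n : ℕ) : State :=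
  (evolution Δ)^[n] (initialState φ₁ φ₂ φ₃ φ₄)

/-- The probability of finding the walker at `x` at time `n`. -/
def prob (Δ : ℝ) (φ₁ φ₂ φ₃ φ₄ : ℂ) (n : ℕ) (x : ℤ) : ℝ :=
  ∑ i : Fin 4, ‖stateAt Δ φ₁ φ₂ φ₃ φ₄ n x i‖ ^ 2

def p (Δ : ℝ) : ℝ := (1 / Real.sqrt 2) * (Real.cos Δ - Real.sin Δ)

def q (Δ : ℝ) : ℝ := (1 / Real.sqrt 2) * (Real.cos Δ + Real.sin Δ)

def d₀ (φ₁ φ₂ φ₃ φ₄ : ℂ) : ℝ := ‖φ₁ - φ₂‖ ^ 2 + ‖φ₃ - φ₄‖ ^ 2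

def d₁ (Δ : ℝ) (φ₁ φ₂ φ₃ φ₄ : ℂ) : ℝ :=
  p Δ * (‖φ₂ - φ₄‖ ^ 2 - ‖φ₁ - φ₃‖ ^ 2) + q Δ * (‖φ₂ + φ₃‖ ^ 2 - ‖φ₁ + φ₄‖ ^ 2)

def d₂ (Δ : ℝ) (φ₁ φ₂ φ₃ φ₄ : ℂ) : ℝ :=
  p Δ * q Δ * (‖φ₁ + φ₂‖ ^ 2 - ‖φ₃ + φ₄‖ ^ 2)
    + 2 * p Δ ^ 2 * (starRingEnd ℂ (φ₁ - φ₄) * (φ₂ - φ₃)).re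
    + 2 * q Δ ^ 2 * (starRingEnd ℂ (φ₁ + φ₃) * (φ₂ + φ₄)).re

/-- The coefficient of the Dirac mass at the origin in the limit law. -/
def atomWeight (Δ : ℝ) (φ₁ φ₂ φ₃ φ₄ : ℂ) : ℝ :=
  1 - d₀ φ₁ φ₂ φ₃ φ₄ / 2
    - (1 - Real.sqrt (1 - p Δ ^ 2)) / (2 * p Δ ^ 2) * d₂ Δ φ₁ φ₂ φ₃ φ₄

/-- The expression for the density of the limit law, meant for `|y| < |p|`. -/
def f (Δ : ℝ) (φ₁ φ₂ φ₃ φ₄ : ℂ) (y : ℝ) : ℝ :=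
  Real.sqrt (1 - p Δ ^ 2)
      / (2 * Real.pi * p Δ ^ 2 * Real.sqrt (p Δ ^ 2 - y ^ 2) * (1 - y ^ 2))
    * (p Δ ^ 2 * d₀ φ₁ φ₂ φ₃ φ₄ + p Δ * d₁ Δ φ₁ φ₂ φ₃ φ₄ * y + d₂ Δ φ₁ φ₂ φ₃ φ₄ * y ^ 2)

/-- The density `f(y) I_{(-|p|, |p|)}(y)`. -/
def density (Δ : ℝ) (φ₁ φ₂ φ₃ φ₄ : ℂ) : ℝ → ℝ :=
  (Ioo (-|p Δ|) |p Δ|).indicator (f Δ φ₁ φ₂ φ₃ φ₄)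

/-- The limit law `A δ₀ + f(y) I_{(-|p|, |p|)}(y) dy`. -/
def limitLaw (Δ : ℝ) (φ₁ φ₂ φ₃ φ₄ : ℂ) : Measure ℝ :=
  ENNReal.ofReal (atomWeight Δ φ₁ φ₂ φ₃ φ₄) • Measure.dirac 0
    + volume.withDensity (fun y => ENNReal.ofReal (density Δ φ₁ φ₂ φ₃ φ₄ y))

end

end GroverWalk

/-!
Parts (B) and (C) are the cases `p = 0` and `q = 0`: there one step of the walk maps each of a short
list of explicit states to the next one, and the formulas follow by induction on time.

Part (A) is proved with characteristic functions. The Fourier transform `∑ₓ exp (i k x) ψ(x)` turns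
one step of the walk into multiplication by a unitary `4 × 4` matrix, the symbol `U(k)`. Its
eigenvalues are `1`, `-1` and `exp (± i ω(k))` with `cos ω(k) = p cos k` (`symbol_quartic`), and for
`0 < p² < 1` they are distinct for every `k`, so that the spectral projections, being Lagrange
polynomials of `U(k)`, depend continuously on `k`. By Parseval's identity the characteristic
function of `X_n / n` at `ξ` is the mean over `k` of the overlap of `U(k)ⁿ φ` and `U(k + ξ / n)ⁿ φ`
(`charFun_map_div`). In the spectral expansion of the overlap the cross terms vanish in the limit,
since eigenspaces of a unitary matrix are orthogonal, while the diagonal terms tend to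
`exp (i ξ θ'(k)) ‖P(k) φ‖²`, where `θ` is the phase of the eigenvalue and `P` its projection
(`tendsto_overlap`). The eigenvalues `±1` have constant phase and produce the atom at the origin.

The contributions of `ω` and `-ω` are exchanged by `k ↦ k + π`, because `U(k + π) = -U(k)`. After a
further symmetrisation under `k ↦ π - k`, which fixes the group velocity `v = ω'`, the squared norm
of the component becomes the polynomial `(p² d₀ + p d₁ v + d₂ v²) / (2 p²)`
(`weight_add_weight_pi_sub`). On `(-π/2, π/2)` the group velocity is a bijection to `(-|p|, |p|)`,
and the change of variables `y = v(k)` gives the density `f` (`integral_density_mul`). Its total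
mass, which determines the weight of the atom, reduces to the integral of `1 / sin² ω`
(`integral_inv_sinOmega_sq`). Lévy's convergence theorem and the portmanteau theorem conclude.
-/

namespace GroverWalk

open scoped Matrix

/-! ### The walks with `p = 0` and `q = 0` -/

theorem delta_add (a b x : ℤ) : delta a (x + b) = delta (a - b) x := by
  unfold delta
  congr 1
  exact propext ⟨fun h => by omega, fun h => by omega⟩

theorem delta_sub (a b x : ℤ) : delta a (x - b) = delta (a + b) x := by
  unfold delta
  congr 1
  exact propext ⟨fun h => by omega, fun h => by omega⟩

theorem evolution_apply (Δ : ℝ) (ψ : State) (x : ℤ) (a b : ℂ)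
    (ha : ((1 / Real.sqrt 2 * Real.cos Δ : ℝ) : ℂ) = a)
    (hb : ((1 / Real.sqrt 2 * Real.sin Δ : ℝ) : ℂ) = b) :
    evolution Δ ψ x =
      ![a * ψ (x + 1) 0 + b * ψ (x + 1) 1 - a * ψ (x + 1) 2 + b * ψ (x + 1) 3,
        b * ψ (x - 1) 0 + a * ψ (x - 1) 1 + b * ψ (x - 1) 2 - a * ψ (x - 1) 3,
        b * ψ (x + 1) 0 - a * ψ (x + 1) 1 - b * ψ (x + 1) 2 - a * ψ (x + 1) 3,
        -a * ψ (x - 1) 0 + b * ψ (x - 1) 1 - a * ψ (x - 1) 2 - b * ψ (x - 1) 3] := by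
  subst ha hb
  funext i
  fin_cases i <;>
    simp [evolution, shiftOp, coinOp, coinMatrix, Matrix.mulVec, dotProduct, Fin.sum_univ_four] <;>
    ring

theorem stateAt_succ (Δ : ℝ) (φ₁ φ₂ φ₃ φ₄ : ℂ) (n : ℕ) :
    stateAt Δ φ₁ φ₂ φ₃ φ₄ (n + 1) = evolution Δ (stateAt Δ φ₁ φ₂ φ₃ φ₄ n) :=
  Function.iterate_succ_apply' _ _ _

theorem inv_sqrt_two_mul_half_sqrt_two : 1 / Real.sqrt 2 * (Real.sqrt 2 / 2) = 1 / 2 := by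
  field_simp

theorem coin_entries_of_p_eq_zero {Δ : ℝ} {j : ℕ}
    (h : (Δ = Real.pi / 4 ∧ j = 0) ∨ (Δ = -(3 * Real.pi / 4) ∧ j = 1)) :
    ((1 / Real.sqrt 2 * Real.cos Δ : ℝ) : ℂ) = (-1) ^ j / 2 ∧
      ((1 / Real.sqrt 2 * Real.sin Δ : ℝ) : ℂ) = (-1) ^ j / 2 := by
  have h3 : (3 * Real.pi / 4 : ℝ) = Real.pi - Real.pi / 4 := by ring
  rcases h with ⟨rfl, rfl⟩ | ⟨rfl, rfl⟩
  · rw [Real.cos_pi_div_four, Real.sin_pi_div_four, inv_sqrt_two_mul_half_sqrt_two]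
    norm_num
  · rw [Real.cos_neg, Real.sin_neg, h3, Real.cos_pi_sub, Real.sin_pi_sub, Real.cos_pi_div_four,
      Real.sin_pi_div_four, mul_neg, inv_sqrt_two_mul_half_sqrt_two]
    norm_num

theorem coin_entries_of_q_eq_zero {Δ : ℝ} {j : ℕ}
    (h : (Δ = -(Real.pi / 4) ∧ j = 0) ∨ (Δ = 3 * Real.pi / 4 ∧ j = 1)) :
    ((1 / Real.sqrt 2 * Real.cos Δ : ℝ) : ℂ) = (-1) ^ j / 2 ∧
      ((1 / Real.sqrt 2 * Real.sin Δ : ℝ) : ℂ) = -((-1) ^ j / 2) := by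
  have h3 : (3 * Real.pi / 4 : ℝ) = Real.pi - Real.pi / 4 := by ring
  rcases h with ⟨rfl, rfl⟩ | ⟨rfl, rfl⟩
  · rw [Real.cos_neg, Real.sin_neg, Real.cos_pi_div_four, Real.sin_pi_div_four, mul_neg,
      inv_sqrt_two_mul_half_sqrt_two]
    norm_num
  · rw [h3, Real.cos_pi_sub, Real.sin_pi_sub, Real.cos_pi_div_four,
      Real.sin_pi_div_four, mul_neg, inv_sqrt_two_mul_half_sqrt_two]
    norm_num

section
variable {Δ : ℝ} {j : ℕ} (φ₁ φ₂ φ₃ φ₄ : ℂ)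

/-- For `p = 0` one step of the walk permutes four explicit states cyclically. -/
theorem evolution_period_four
    (h : (Δ = Real.pi / 4 ∧ j = 0) ∨ (Δ = -(3 * Real.pi / 4) ∧ j = 1)) :
    let S₀ : State := fun x => delta 0 x • ![φ₁, φ₂, φ₃, φ₄]
    let S₁ : State := fun x => (((-1) ^ j / 2 : ℂ) * delta (-1) x) •
              ![φ₁ + φ₂ - φ₃ + φ₄, 0, φ₁ - φ₂ - φ₃ - φ₄, 0]
          + (((-1) ^ j / 2 : ℂ) * delta 1 x) •
              ![0, φ₁ + φ₂ + φ₃ - φ₄, 0, -φ₁ + φ₂ - φ₃ - φ₄]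
    let S₂ : State := fun x => ((1 / 2 : ℂ) * delta (-2) x) • ![φ₂ + φ₄, 0, φ₂ + φ₄, 0]
          + ((1 / 2 : ℂ) * delta 0 x) • ![φ₂ - φ₄, φ₁ - φ₃, φ₄ - φ₂, φ₃ - φ₁]
          + ((1 / 2 : ℂ) * delta 2 x) • ![0, φ₁ + φ₃, 0, φ₁ + φ₃]
    let S₃ : State := fun x => (((-1) ^ j / 2 : ℂ) * delta (-1) x) •
              ![φ₂ - φ₄, φ₂ + φ₄, φ₂ - φ₄, -φ₂ - φ₄]
          + (((-1) ^ j / 2 : ℂ) * delta 1 x) •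
              ![φ₁ + φ₃, φ₁ - φ₃, -φ₁ - φ₃, φ₁ - φ₃]
    evolution Δ S₀ = S₁ ∧ evolution Δ S₁ = S₂ ∧ evolution Δ S₂ = S₃ ∧ evolution Δ S₃ = S₀ := by
  obtain ⟨ha, hb⟩ := coin_entries_of_p_eq_zero h
  have hj : ((-1 : ℂ) ^ j) * (-1) ^ j = 1 := by
    rw [← mul_pow]; norm_num
  generalize (-1 : ℂ) ^ j = s at ha hb hj ⊢
  clear h
  intro S₀ S₁ S₂ S₃
  refine ⟨?_, ?_, ?_, ?_⟩ <;> funext x i <;> rw [evolution_apply Δ _ x _ _ ha hb] <;>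
    fin_cases i <;>
    simp [S₀, S₁, S₂, S₃, delta_add, delta_sub] <;> grind

/-- The state at the even time `n` of the walk with `q = 0`. -/
noncomputable def evenState (n : ℤ) : State := fun x =>
  (delta (-n) x / 2) • ![φ₁ - φ₃, 0, φ₃ - φ₁, 0]
    + (delta 0 x / 2) • ![φ₁ + φ₃, φ₂ + φ₄, φ₁ + φ₃, φ₂ + φ₄]
    + (delta n x / 2) • ![0, φ₂ - φ₄, 0, φ₄ - φ₂]

/-- The state at the odd time `n` of the walk with `q = 0`. -/
noncomputable def oddState (j : ℕ) (n : ℤ) : State := fun x =>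
  ((-1) ^ j : ℂ) •
    ((delta (-n) x / 2) • ![φ₁ - φ₃, 0, φ₃ - φ₁, 0]
      - (delta (-1) x / 2) • ![φ₂ + φ₄, 0, φ₂ + φ₄, 0]
      - (delta 1 x / 2) • ![0, φ₁ + φ₃, 0, φ₁ + φ₃]
      + (delta n x / 2) • ![0, φ₂ - φ₄, 0, φ₄ - φ₂])

theorem evolution_evenState_oddState
    (h : (Δ = -(Real.pi / 4) ∧ j = 0) ∨ (Δ = 3 * Real.pi / 4 ∧ j = 1)) (n : ℤ) :
    evolution Δ (evenState φ₁ φ₂ φ₃ φ₄ n) = oddState φ₁ φ₂ φ₃ φ₄ j (n + 1) ∧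
      evolution Δ (oddState φ₁ φ₂ φ₃ φ₄ j n) = evenState φ₁ φ₂ φ₃ φ₄ (n + 1) := by
  obtain ⟨ha, hb⟩ := coin_entries_of_q_eq_zero h
  have hj : ((-1 : ℂ) ^ j) * (-1) ^ j = 1 := by
    rw [← mul_pow]; norm_num
  unfold oddState evenState
  generalize (-1 : ℂ) ^ j = s at ha hb hj ⊢
  clear h
  have h1 : -n - 1 = -1 + -n := by ring
  refine ⟨?_, ?_⟩ <;> funext x i <;> rw [evolution_apply Δ _ x _ _ ha hb] <;>
    fin_cases i <;>
    simp [delta_add, delta_sub, h1] <;> grind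

theorem stateAt_of_p_eq_zero
    (h : (Δ = Real.pi / 4 ∧ j = 0) ∨ (Δ = -(3 * Real.pi / 4) ∧ j = 1)) (m : ℕ) (x : ℤ) :
    stateAt Δ φ₁ φ₂ φ₃ φ₄ (4 * m) x = delta 0 x • ![φ₁, φ₂, φ₃, φ₄] ∧
    stateAt Δ φ₁ φ₂ φ₃ φ₄ (4 * m + 1) x =
      (((-1) ^ j / 2 : ℂ) * delta (-1) x) •
          ![φ₁ + φ₂ - φ₃ + φ₄, 0, φ₁ - φ₂ - φ₃ - φ₄, 0]
      + (((-1) ^ j / 2 : ℂ) * delta 1 x) •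
          ![0, φ₁ + φ₂ + φ₃ - φ₄, 0, -φ₁ + φ₂ - φ₃ - φ₄] ∧
    stateAt Δ φ₁ φ₂ φ₃ φ₄ (4 * m + 2) x =
      ((1 / 2 : ℂ) * delta (-2) x) • ![φ₂ + φ₄, 0, φ₂ + φ₄, 0]
      + ((1 / 2 : ℂ) * delta 0 x) • ![φ₂ - φ₄, φ₁ - φ₃, φ₄ - φ₂, φ₃ - φ₁]
      + ((1 / 2 : ℂ) * delta 2 x) • ![0, φ₁ + φ₃, 0, φ₁ + φ₃] ∧
    stateAt Δ φ₁ φ₂ φ₃ φ₄ (4 * m + 3) x =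
      (((-1) ^ j / 2 : ℂ) * delta (-1) x) •
          ![φ₂ - φ₄, φ₂ + φ₄, φ₂ - φ₄, -φ₂ - φ₄]
      + (((-1) ^ j / 2 : ℂ) * delta 1 x) •
          ![φ₁ + φ₃, φ₁ - φ₃, -φ₁ - φ₃, φ₁ - φ₃] := by
  obtain ⟨h01, h12, h23, h30⟩ := evolution_period_four φ₁ φ₂ φ₃ φ₄ h
  have h0 : stateAt Δ φ₁ φ₂ φ₃ φ₄ (4 * m) = fun x => delta 0 x • ![φ₁, φ₂, φ₃, φ₄] := by
    induction m with
    | zero => rfl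
    | succ m ih =>
      rw [show 4 * (m + 1) = 4 * m + 1 + 1 + 1 + 1 by ring, stateAt_succ, stateAt_succ,
        stateAt_succ, stateAt_succ, ih, h01, h12, h23, h30]
  have h1 := stateAt_succ Δ φ₁ φ₂ φ₃ φ₄ (4 * m)
  rw [h0, h01] at h1
  have h2 := stateAt_succ Δ φ₁ φ₂ φ₃ φ₄ (4 * m + 1)
  rw [h1, h12] at h2
  have h3 := stateAt_succ Δ φ₁ φ₂ φ₃ φ₄ (4 * m + 2)
  rw [h2, h23] at h3
  exact ⟨congrFun h0 x, congrFun h1 x, congrFun h2 x, congrFun h3 x⟩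

theorem stateAt_of_q_eq_zero
    (h : (Δ = -(Real.pi / 4) ∧ j = 0) ∨ (Δ = 3 * Real.pi / 4 ∧ j = 1)) (n m : ℕ) (x : ℤ) :
    (n = 2 * m →
      stateAt Δ φ₁ φ₂ φ₃ φ₄ n x =
        (delta (-(n : ℤ)) x / 2) • ![φ₁ - φ₃, 0, φ₃ - φ₁, 0]
        + (delta 0 x / 2) • ![φ₁ + φ₃, φ₂ + φ₄, φ₁ + φ₃, φ₂ + φ₄]
        + (delta (n : ℤ) x / 2) • ![0, φ₂ - φ₄, 0, φ₄ - φ₂]) ∧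
    (n = 2 * m + 1 →
      stateAt Δ φ₁ φ₂ φ₃ φ₄ n x =
        ((-1) ^ j : ℂ) •
          ((delta (-(n : ℤ)) x / 2) • ![φ₁ - φ₃, 0, φ₃ - φ₁, 0]
          - (delta (-1) x / 2) • ![φ₂ + φ₄, 0, φ₂ + φ₄, 0]
          - (delta 1 x / 2) • ![0, φ₁ + φ₃, 0, φ₁ + φ₃]
          + (delta (n : ℤ) x / 2) • ![0, φ₂ - φ₄, 0, φ₄ - φ₂])) := by
  have hstep := evolution_evenState_oddState φ₁ φ₂ φ₃ φ₄ h
  have hE : ∀ m : ℕ, stateAt Δ φ₁ φ₂ φ₃ φ₄ (2 * m) = evenState φ₁ φ₂ φ₃ φ₄ ((2 * m : ℕ) : ℤ) := by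
    intro m
    induction m with
    | zero =>
      funext x i
      fin_cases i <;> simp [stateAt, initialState, evenState] <;> ring
    | succ m ih =>
      rw [show 2 * (m + 1) = 2 * m + 1 + 1 by ring, stateAt_succ, stateAt_succ, ih,
        (hstep _).1, (hstep _).2]
      push_cast
      rfl
  have hO : ∀ m : ℕ, stateAt Δ φ₁ φ₂ φ₃ φ₄ (2 * m + 1) = oddState φ₁ φ₂ φ₃ φ₄ j ((2 * m + 1 : ℕ) : ℤ) := by
    intro m
    rw [stateAt_succ, hE, (hstep _).1]
    push_cast
    rfl
  constructor
  · rintro rfl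
    rw [hE, evenState]
  · rintro rfl
    rw [hO, oddState]

end

/-! ### Spectral decomposition of a unitary matrix with simple spectrum -/

/-- The Lagrange interpolation polynomial of the point `μ i` among the four points `μ`, evaluated
at the matrix `U`. If `U` is annihilated by the monic quartic with roots `μ`, this is the projection
to the eigenspace of `μ i`. The three other points are addressed cyclically as `μ (i + 1)`,
`μ (i + 2)`, `μ (i + 3)`. -/
noncomputable def spectralProj (U : Matrix (Fin 4) (Fin 4) ℂ) (μ : Fin 4 → ℂ) (i : Fin 4) :
    Matrix (Fin 4) (Fin 4) ℂ :=
  ((μ i - μ (i + 1)) * (μ i - μ (i + 2)) * (μ i - μ (i + 3)))⁻¹ •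
    (U ^ 3 - (μ (i + 1) + μ (i + 2) + μ (i + 3)) • U ^ 2
      + (μ (i + 1) * μ (i + 2) + μ (i + 1) * μ (i + 3) + μ (i + 2) * μ (i + 3)) • U
      - (μ (i + 1) * μ (i + 2) * μ (i + 3)) • 1)

theorem sum_spectralProj (U : Matrix (Fin 4) (Fin 4) ℂ) {μ : Fin 4 → ℂ}
    (hμ : Function.Injective μ) : ∑ i, spectralProj U μ i = 1 := by
  have h : ∀ i j, i ≠ j → μ i - μ j ≠ 0 := fun i j hij => sub_ne_zero.2 (hμ.ne hij)
  have h01 := h 0 1 (by decide)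
  have h02 := h 0 2 (by decide)
  have h03 := h 0 3 (by decide)
  have h12 := h 1 2 (by decide)
  have h13 := h 1 3 (by decide)
  have h23 := h 2 3 (by decide)
  have h10 := h 1 0 (by decide)
  have h20 := h 2 0 (by decide)
  have h30 := h 3 0 (by decide)
  have h21 := h 2 1 (by decide)
  have h31 := h 3 1 (by decide)
  have h32 := h 3 2 (by decide)
  have e1 : (1 : Fin 4) + 3 = 0 := rfl
  have e2 : (2 : Fin 4) + 2 = 0 := rfl
  have e3 : (2 : Fin 4) + 3 = 1 := rfl
  have e4 : (3 : Fin 4) + 1 = 0 := rfl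
  have e5 : (3 : Fin 4) + 2 = 1 := rfl
  have e6 : (3 : Fin 4) + 3 = 2 := rfl
  have e7 : (1 : Fin 4) + 1 = 2 := rfl
  have e8 : (1 : Fin 4) + 2 = 3 := rfl
  have e9 : (2 : Fin 4) + 1 = 3 := rfl
  simp only [Fin.sum_univ_four, spectralProj, zero_add, e1, e2, e3, e4, e5, e6, e7, e8, e9]
  generalize μ 0 = a at *
  generalize μ 1 = b at *
  generalize μ 2 = c at *
  generalize μ 3 = d at *
  match_scalars <;> field_simp <;> ring

theorem mul_spectralProj {U : Matrix (Fin 4) (Fin 4) ℂ} {μ : Fin 4 → ℂ} {e₁ e₂ e₃ e₄ : ℂ}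
    (hU : U ^ 4 - e₁ • U ^ 3 + e₂ • U ^ 2 - e₃ • U + e₄ • 1 = 0)
    (h₁ : μ 0 + μ 1 + μ 2 + μ 3 = e₁)
    (h₂ : μ 0 * μ 1 + μ 0 * μ 2 + μ 0 * μ 3 + μ 1 * μ 2 + μ 1 * μ 3 + μ 2 * μ 3 = e₂)
    (h₃ : μ 0 * μ 1 * μ 2 + μ 0 * μ 1 * μ 3 + μ 0 * μ 2 * μ 3 + μ 1 * μ 2 * μ 3 = e₃)
    (h₄ : μ 0 * μ 1 * μ 2 * μ 3 = e₄) (i : Fin 4) :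
    U * spectralProj U μ i = μ i • spectralProj U μ i := by
  have key : ∀ a b c d : ℂ, a + b + c + d = e₁ →
      a * b + a * c + a * d + b * c + b * d + c * d = e₂ →
      a * b * c + a * b * d + a * c * d + b * c * d = e₃ → a * b * c * d = e₄ →
      U * (U ^ 3 - (b + c + d) • U ^ 2 + (b * c + b * d + c * d) • U - (b * c * d) • 1) =
        a • (U ^ 3 - (b + c + d) • U ^ 2 + (b * c + b * d + c * d) • U - (b * c * d) • 1) := by
    rintro a b c d rfl rfl rfl rfl
    rw [← sub_eq_zero, ← hU]
    simp only [mul_sub, mul_add, Matrix.mul_smul, ← pow_succ', ← sq, mul_one]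
    module
  unfold spectralProj
  rw [Matrix.mul_smul, smul_comm]
  congr 1
  apply key
  · rw [← h₁]; fin_cases i <;> simp <;> ring
  · rw [← h₂]; fin_cases i <;> simp <;> ring
  · rw [← h₃]; fin_cases i <;> simp <;> ring
  · rw [← h₄]; fin_cases i <;> simp <;> ring

theorem dotProduct_mulVec_of_unitary {U : Matrix (Fin 4) (Fin 4) ℂ} (hU : Uᴴ * U = 1)
    (v w : Fin 4 → ℂ) : star (U *ᵥ v) ⬝ᵥ (U *ᵥ w) = star v ⬝ᵥ w := by
  rw [Matrix.star_mulVec, ← Matrix.dotProduct_mulVec, Matrix.mulVec_mulVec, hU, Matrix.one_mulVec]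

theorem dotProduct_eq_zero_of_unitary {U : Matrix (Fin 4) (Fin 4) ℂ} (hU : Uᴴ * U = 1)
    {v w : Fin 4 → ℂ} {α β : ℂ} (hv : U *ᵥ v = α • v) (hw : U *ᵥ w = β • w)
    (hα : ‖α‖ = 1) (hαβ : α ≠ β) : star v ⬝ᵥ w = 0 := by
  have h := dotProduct_mulVec_of_unitary hU v w
  rw [hv, hw, star_smul, smul_dotProduct, dotProduct_smul, smul_eq_mul, smul_eq_mul] at h
  by_contra h0
  have h1 : star α * β = 1 := by
    have : (star α * β) * (star v ⬝ᵥ w) = 1 * (star v ⬝ᵥ w) := by rw [one_mul, mul_assoc, h]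
    exact mul_right_cancel₀ h0 this
  have h2 : α * star α = 1 := by
    rw [Complex.star_def, Complex.mul_conj, Complex.normSq_eq_norm_sq, hα]; simp
  exact hαβ (by linear_combination (-α) * h1 + β * h2)

/-- The squared norm `∑ |vᵢ|²`. -/
noncomputable def normSq (v : Fin 4 → ℂ) : ℝ := ∑ i, ‖v i‖ ^ 2

theorem star_dotProduct_self (v : Fin 4 → ℂ) : star v ⬝ᵥ v = (normSq v : ℂ) := by
  simp only [dotProduct, normSq, Pi.star_apply, Complex.ofReal_sum]
  refine Finset.sum_congr rfl fun i _ => ?_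
  rw [Complex.star_def, mul_comm, Complex.mul_conj, Complex.normSq_eq_norm_sq]

theorem normSq_nonneg (v : Fin 4 → ℂ) : 0 ≤ normSq v :=
  Finset.sum_nonneg fun _ _ => by positivity

/-! ### The symbol of the walk -/

/-- The Fourier symbol of the evolution operator: the unitary matrix by which the evolution
multiplies `∑ₓ exp (i k x) ψ(x)`. -/
noncomputable def symbol (Δ k : ℝ) : Matrix (Fin 4) (Fin 4) ℂ :=
  Matrix.diagonal ![Complex.exp (-(k * Complex.I)), Complex.exp (k * Complex.I),
      Complex.exp (-(k * Complex.I)), Complex.exp (k * Complex.I)] *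
    (coinMatrix Δ).map (fun r : ℝ => (r : ℂ))

theorem exists_coin_entries (Δ : ℝ) : ∃ a b : ℝ, a = 1 / Real.sqrt 2 * Real.cos Δ ∧
    b = 1 / Real.sqrt 2 * Real.sin Δ ∧ a ^ 2 + b ^ 2 = 1 / 2 ∧ p Δ = a - b ∧ q Δ = a + b := by
  refine ⟨_, _, rfl, rfl, ?_, ?_, ?_⟩
  · rw [mul_pow, mul_pow, ← mul_add, Real.cos_sq_add_sin_sq, div_pow, Real.sq_sqrt (by norm_num)]
    norm_num
  · rw [p]; ring
  · rw [q]; ring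

theorem p_sq_add_q_sq (Δ : ℝ) : p Δ ^ 2 + q Δ ^ 2 = 1 := by
  obtain ⟨a, b, -, -, h, hp, hq⟩ := exists_coin_entries Δ
  rw [hp, hq]; linear_combination 2 * h

theorem symbol_eq {Δ k a b : ℝ} {z w : ℂ} (ha : a = 1 / Real.sqrt 2 * Real.cos Δ)
    (hb : b = 1 / Real.sqrt 2 * Real.sin Δ) (hz : z = Complex.exp (k * Complex.I))
    (hw : w = Complex.exp (-(k * Complex.I))) :
    symbol Δ k = !![w * a, w * b, -(w * a), w * b; z * b, z * a, z * b, -(z * a);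
      w * b, -(w * a), -(w * b), -(w * a); -(z * a), z * b, -(z * a), -(z * b)] := by
  subst ha hb hz hw
  ext i j
  fin_cases i <;> fin_cases j <;> simp [symbol, coinMatrix]

theorem symbol_conjTranspose_eq {Δ k a b : ℝ} {z w : ℂ} (ha : a = 1 / Real.sqrt 2 * Real.cos Δ)
    (hb : b = 1 / Real.sqrt 2 * Real.sin Δ) (hz : z = Complex.exp (k * Complex.I))
    (hw : w = Complex.exp (-(k * Complex.I))) :
    (symbol Δ k)ᴴ = !![z * a, w * b, z * b, -(w * a); z * b, w * a, -(z * a), w * b;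
      -(z * a), w * b, -(z * b), -(w * a); z * b, -(w * a), -(z * a), -(w * b)] := by
  have h1 : (starRingEnd ℂ) z = w := by
    rw [hz, hw, ← Complex.exp_conj]; simp
  have h2 : (starRingEnd ℂ) w = z := by rw [← h1, Complex.conj_conj]
  rw [symbol_eq ha hb hz hw]
  ext i j
  fin_cases i <;> fin_cases j <;> simp [h1, h2]

theorem symbol_unitary (Δ k : ℝ) : (symbol Δ k)ᴴ * symbol Δ k = 1 := by
  obtain ⟨a, b, ha, hb, h, -, -⟩ := exists_coin_entries Δ
  have h' : (a : ℂ) ^ 2 + (b : ℂ) ^ 2 = 1 / 2 := by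
    have := congrArg ((↑) : ℝ → ℂ) h
    push_cast at this
    exact this
  obtain ⟨z, hz⟩ : ∃ z, z = Complex.exp (k * Complex.I) := ⟨_, rfl⟩
  obtain ⟨w, hw⟩ : ∃ w, w = Complex.exp (-(k * Complex.I)) := ⟨_, rfl⟩
  have hzw : z * w = 1 := by rw [hz, hw, ← Complex.exp_add]; simp
  rw [symbol_conjTranspose_eq ha hb hz hw, symbol_eq ha hb hz hw]
  clear h ha hb hz hw
  generalize (a : ℂ) = a at *
  generalize (b : ℂ) = b at *
  ext i j
  fin_cases i <;> fin_cases j <;> simp [Matrix.mul_apply, Fin.sum_univ_four] <;> grind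

set_option maxHeartbeats 1000000 in
/-- The polynomial relation of the symbol in the form that only involves second powers of its
entries. -/
theorem symbol_sq_sub_conjTranspose_sq (Δ k : ℝ) :
    symbol Δ k ^ 2 - (symbol Δ k)ᴴ ^ 2 =
      (2 * (p Δ * Real.cos k : ℝ) : ℂ) • (symbol Δ k - (symbol Δ k)ᴴ) := by
  obtain ⟨a, b, ha, hb, h, hp, -⟩ := exists_coin_entries Δ
  obtain ⟨z, hz⟩ : ∃ z, z = Complex.exp (k * Complex.I) := ⟨_, rfl⟩
  obtain ⟨w, hw⟩ : ∃ w, w = Complex.exp (-(k * Complex.I)) := ⟨_, rfl⟩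
  have hzw : z * w = 1 := by rw [hz, hw, ← Complex.exp_add]; simp
  have hc : (2 * (p Δ * Real.cos k : ℝ) : ℂ) = (a - b) * (z + w) := by
    rw [hp, hz, hw]
    push_cast
    rw [Complex.cos]
    ring_nf
  rw [hc, symbol_conjTranspose_eq ha hb hz hw, symbol_eq ha hb hz hw]
  clear h ha hb hz hw hp hc
  generalize (a : ℂ) = a at *
  generalize (b : ℂ) = b at *
  ext i j
  fin_cases i <;> fin_cases j <;> simp [pow_two] <;> grind

/-- The characteristic polynomial of the symbol is `(X² - 1) (X² - 2 c X + 1)` with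
`c = p cos k`. -/
theorem symbol_quartic (Δ k : ℝ) :
    symbol Δ k ^ 4 - (2 * (p Δ * Real.cos k : ℝ) : ℂ) • symbol Δ k ^ 3 + (0 : ℂ) • symbol Δ k ^ 2
      - (-(2 * (p Δ * Real.cos k : ℝ)) : ℂ) • symbol Δ k + (-1 : ℂ) • 1 = 0 := by
  have h := symbol_sq_sub_conjTranspose_sq Δ k
  have hU := symbol_unitary Δ k
  generalize symbol Δ k = U at *
  generalize (2 * (p Δ * Real.cos k : ℝ) : ℂ) = c at *
  -- multiplying the relation for `U² - (Uᴴ)²` by `U²` clears the adjoints, which are inverses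
  have h2 : Uᴴ ^ 2 * U ^ 2 = 1 := by
    rw [pow_two, pow_two, mul_assoc, ← mul_assoc Uᴴ U U, hU, one_mul, hU]
  have h3 : Uᴴ * U ^ 2 = U := by rw [pow_two, ← mul_assoc, hU, one_mul]
  have h4 := congrArg (· * U ^ 2) h
  simp only [sub_mul, smul_mul_assoc, h2, h3, ← pow_add, ← pow_succ'] at h4
  rw [show U ^ 4 = U ^ (2 + 2) from rfl, eq_add_of_sub_eq h4]
  norm_num
  module

/-! ### Phases of the eigenvalues -/

/-- The non-constant phase `ω(k) = arccos (p cos k)` of the eigenvalues of the symbol. -/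
noncomputable def omega (Δ k : ℝ) : ℝ := Real.arccos (p Δ * Real.cos k)

/-- The phases `0, π, ω, -ω` of the eigenvalues of the symbol. -/
noncomputable def phase (Δ k : ℝ) : Fin 4 → ℝ := ![0, Real.pi, omega Δ k, -omega Δ k]

/-- The eigenvalues `1, -1, exp (iω), exp (-iω)` of the symbol. -/
noncomputable def eigenvalue (Δ k : ℝ) (i : Fin 4) : ℂ := Complex.exp (phase Δ k i * Complex.I)

/-- The sine of the phase `ω`, that is `√(1 - p² cos² k)`. -/
noncomputable def sinOmega (Δ k : ℝ) : ℝ := Real.sqrt (1 - (p Δ * Real.cos k) ^ 2)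

/-- The group velocity `ω'(k)`. -/
noncomputable def velocity (Δ k : ℝ) : ℝ := p Δ * Real.sin k / sinOmega Δ k

theorem p_cos_sq_lt_one {Δ : ℝ} (hp : p Δ ^ 2 < 1) (k : ℝ) : (p Δ * Real.cos k) ^ 2 < 1 := by
  rw [mul_pow]
  nlinarith [Real.cos_sq_le_one k, sq_nonneg (p Δ), sq_nonneg (Real.cos k)]

theorem sinOmega_pos {Δ : ℝ} (hp : p Δ ^ 2 < 1) (k : ℝ) : 0 < sinOmega Δ k :=
  Real.sqrt_pos.2 (sub_pos.2 (p_cos_sq_lt_one hp k))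

theorem sinOmega_sq {Δ : ℝ} (hp : p Δ ^ 2 < 1) (k : ℝ) :
    sinOmega Δ k ^ 2 = 1 - (p Δ * Real.cos k) ^ 2 :=
  Real.sq_sqrt (sub_pos.2 (p_cos_sq_lt_one hp k)).le

theorem cos_omega {Δ : ℝ} (hp : p Δ ^ 2 < 1) (k : ℝ) :
    Real.cos (omega Δ k) = p Δ * Real.cos k := by
  have h := abs_le.1 ((sq_le_one_iff_abs_le_one _).1 (p_cos_sq_lt_one hp k).le)
  exact Real.cos_arccos h.1 h.2

theorem sin_omega (Δ k : ℝ) : Real.sin (omega Δ k) = sinOmega Δ k := Real.sin_arccos _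

theorem hasDerivAt_omega {Δ : ℝ} (hp : p Δ ^ 2 < 1) (k : ℝ) :
    HasDerivAt (omega Δ) (velocity Δ k) k := by
  have h := abs_lt.1 ((sq_lt_one_iff_abs_lt_one _).1 (p_cos_sq_lt_one hp k))
  have h1 := (Real.hasDerivAt_arccos h.1.ne' h.2.ne).comp k
    ((Real.hasDerivAt_cos k).const_mul (p Δ))
  refine h1.congr_deriv ?_
  rw [velocity, sinOmega]
  ring

theorem hasDerivAt_phase {Δ : ℝ} (hp : p Δ ^ 2 < 1) (k : ℝ) (i : Fin 4) :
    HasDerivAt (fun k => phase Δ k i) ((![0, 0, velocity Δ k, -velocity Δ k] : Fin 4 → ℝ) i) k := by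
  fin_cases i
  · exact hasDerivAt_const k (0 : ℝ)
  · exact hasDerivAt_const k Real.pi
  · exact hasDerivAt_omega hp k
  · exact (hasDerivAt_omega hp k).neg

theorem eigenvalue_zero (Δ k : ℝ) : eigenvalue Δ k 0 = 1 := by simp [eigenvalue, phase]

theorem eigenvalue_one (Δ k : ℝ) : eigenvalue Δ k 1 = -1 := by simp [eigenvalue, phase]

theorem eigenvalue_two {Δ : ℝ} (hp : p Δ ^ 2 < 1) (k : ℝ) :
    eigenvalue Δ k 2 = (p Δ * Real.cos k : ℝ) + sinOmega Δ k * Complex.I := by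
  simp only [eigenvalue, phase, Matrix.cons_val]
  rw [Complex.exp_mul_I, ← Complex.ofReal_cos, ← Complex.ofReal_sin, cos_omega hp, sin_omega]

theorem eigenvalue_three {Δ : ℝ} (hp : p Δ ^ 2 < 1) (k : ℝ) :
    eigenvalue Δ k 3 = (p Δ * Real.cos k : ℝ) - sinOmega Δ k * Complex.I := by
  simp only [eigenvalue, phase, Matrix.cons_val]
  rw [Complex.exp_mul_I, ← Complex.ofReal_cos, ← Complex.ofReal_sin, Real.cos_neg, Real.sin_neg,
    cos_omega hp, sin_omega]
  push_cast
  ring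

theorem norm_eigenvalue (Δ k : ℝ) (i : Fin 4) : ‖eigenvalue Δ k i‖ = 1 :=
  Complex.norm_exp_ofReal_mul_I _

/-- The imaginary parts `0, 0, sin ω, -sin ω` separate all pairs of eigenvalues except `1, -1`. -/
theorem eigenvalue_injective {Δ : ℝ} (hp : p Δ ^ 2 < 1) (k : ℝ) :
    Function.Injective (eigenvalue Δ k) := by
  have hs := sinOmega_pos hp k
  have key : ∀ i j, i < j → eigenvalue Δ k i ≠ eigenvalue Δ k j := by
    intro i j hij h
    have hi := congrArg Complex.im h
    have hr := congrArg Complex.re h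
    fin_cases i <;> fin_cases j <;>
      simp [eigenvalue_zero, eigenvalue_one, eigenvalue_two hp, eigenvalue_three hp] at hij hi hr <;>
      linarith
  intro i j h
  rcases lt_trichotomy i j with hij | hij | hij
  · exact absurd h (key i j hij)
  · exact hij
  · exact absurd h.symm (key j i hij)

/-! ### Spectral components of a vector -/

/-- The component of `φ` in the eigenspace of the `i`-th eigenvalue of the symbol. -/
noncomputable def component (Δ : ℝ) (φ : Fin 4 → ℂ) (k : ℝ) (i : Fin 4) : Fin 4 → ℂ :=
  spectralProj (symbol Δ k) (eigenvalue Δ k) i *ᵥ φ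

theorem sum_component {Δ : ℝ} (hp : p Δ ^ 2 < 1) (φ : Fin 4 → ℂ) (k : ℝ) :
    ∑ i, component Δ φ k i = φ := by
  simp only [component]
  rw [← Matrix.sum_mulVec, sum_spectralProj _ (eigenvalue_injective hp k), Matrix.one_mulVec]

theorem symbol_mulVec_component {Δ : ℝ} (hp : p Δ ^ 2 < 1) (φ : Fin 4 → ℂ) (k : ℝ) (i : Fin 4) :
    symbol Δ k *ᵥ component Δ φ k i = eigenvalue Δ k i • component Δ φ k i := by
  have hs : (sinOmega Δ k : ℂ) ^ 2 = 1 - (p Δ * Real.cos k : ℝ) ^ 2 := by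
    exact_mod_cast congrArg ((↑) : ℝ → ℂ) (sinOmega_sq hp k)
  rw [component, Matrix.mulVec_mulVec, mul_spectralProj (symbol_quartic Δ k), Matrix.smul_mulVec]
  all_goals
    rw [eigenvalue_zero, eigenvalue_one, eigenvalue_two hp, eigenvalue_three hp]
    generalize ((p Δ * Real.cos k : ℝ) : ℂ) = c at *
    generalize (sinOmega Δ k : ℂ) = s at *
  · ring
  · linear_combination (-s ^ 2) * Complex.I_sq + hs
  · ring
  · linear_combination (s ^ 2) * Complex.I_sq - hs

theorem symbol_pow_mulVec {Δ : ℝ} (hp : p Δ ^ 2 < 1) (φ : Fin 4 → ℂ) (k : ℝ) (n : ℕ) :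
    symbol Δ k ^ n *ᵥ φ = ∑ i, eigenvalue Δ k i ^ n • component Δ φ k i := by
  induction n with
  | zero => simpa using (sum_component hp φ k).symm
  | succ n ih =>
    rw [pow_succ', ← Matrix.mulVec_mulVec, ih, Matrix.mulVec_sum]
    refine Finset.sum_congr rfl fun i _ => ?_
    rw [Matrix.mulVec_smul, symbol_mulVec_component hp, smul_smul, pow_succ]

theorem component_orthogonal {Δ : ℝ} (hp : p Δ ^ 2 < 1) (φ : Fin 4 → ℂ) (k : ℝ) {i j : Fin 4}
    (hij : i ≠ j) : star (component Δ φ k i) ⬝ᵥ component Δ φ k j = 0 :=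
  dotProduct_eq_zero_of_unitary (symbol_unitary Δ k) (symbol_mulVec_component hp φ k i)
    (symbol_mulVec_component hp φ k j) (norm_eigenvalue Δ k i) ((eigenvalue_injective hp k).ne hij)

theorem continuous_symbol (Δ : ℝ) : Continuous (symbol Δ) := by
  unfold symbol
  refine Continuous.matrix_mul (Continuous.matrix_diagonal ?_) continuous_const
  refine continuous_pi fun i => ?_
  fin_cases i <;> simp <;> fun_prop

/-- Continuity in `k` is where the simplicity of the spectrum for every `k` enters. -/
theorem continuous_component {Δ : ℝ} (hp : p Δ ^ 2 < 1) (φ : Fin 4 → ℂ) (i : Fin 4) :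
    Continuous fun k => component Δ φ k i := by
  have hU := continuous_symbol Δ
  have hμ : ∀ i, Continuous fun k => eigenvalue Δ k i := by
    intro i
    have h : Continuous fun k => phase Δ k i :=
      continuous_iff_continuousAt.2 fun k => (hasDerivAt_phase hp k i).continuousAt
    unfold eigenvalue
    fun_prop
  have hne : ∀ j, i ≠ j → ∀ k, eigenvalue Δ k i - eigenvalue Δ k j ≠ 0 := fun j hij k =>
    sub_ne_zero.2 ((eigenvalue_injective hp k).ne hij)
  have h1 := hne (i + 1) (by fin_cases i <;> decide)
  have h2 := hne (i + 2) (by fin_cases i <;> decide)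
  have h3 := hne (i + 3) (by fin_cases i <;> decide)
  unfold component spectralProj
  refine Continuous.matrix_mulVec (Continuous.smul (Continuous.inv₀ ?_ fun k =>
    mul_ne_zero (mul_ne_zero (h1 k) (h2 k)) (h3 k)) ?_) continuous_const
  · fun_prop
  · fun_prop

/-- Expansion of the quadratic form of `Uⁿ` in the spectral components. -/
theorem star_dotProduct_symbol_pow_mulVec {Δ : ℝ} (hp : p Δ ^ 2 < 1) (φ : Fin 4 → ℂ) (k : ℝ)
    (n : ℕ) : star φ ⬝ᵥ (symbol Δ k ^ n *ᵥ φ) =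
      ∑ i, eigenvalue Δ k i ^ n * (normSq (component Δ φ k i) : ℂ) := by
  have hstar : star φ = ∑ j, star (component Δ φ k j) := by
    conv_lhs => rw [← sum_component hp φ k]
    rw [star_sum]
  rw [symbol_pow_mulVec hp, dotProduct_sum]
  refine Finset.sum_congr rfl fun i _ => ?_
  rw [dotProduct_smul, smul_eq_mul, ← star_dotProduct_self]
  congr 1
  rw [hstar, sum_dotProduct, Finset.sum_eq_single i]
  · exact fun j _ hj => component_orthogonal hp φ k hj
  · simp

theorem sum_normSq_component {Δ : ℝ} (hp : p Δ ^ 2 < 1) (φ : Fin 4 → ℂ) (k : ℝ) :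
    ∑ i, normSq (component Δ φ k i) = normSq φ := by
  have h := star_dotProduct_symbol_pow_mulVec hp φ k 0
  simp only [pow_zero, Matrix.one_mulVec, one_mul, star_dotProduct_self] at h
  exact_mod_cast h.symm

/-- The squared norm of the component of `φ` with phase `ω(k)`, written through the quadratic forms
of `U(k)` and `U(k)²`; see `normSq_component_two_three`. -/
noncomputable def weight (Δ : ℝ) (φ : Fin 4 → ℂ) (k : ℝ) : ℝ :=
  (normSq φ - (star φ ⬝ᵥ (symbol Δ k ^ 2 *ᵥ φ)).re
    + 2 * sinOmega Δ k * (star φ ⬝ᵥ (symbol Δ k *ᵥ φ)).im) / (4 * sinOmega Δ k ^ 2)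

theorem sinOmega_add_pi (Δ k : ℝ) : sinOmega Δ (k + Real.pi) = sinOmega Δ k := by
  simp [sinOmega]

theorem symbol_add_pi (Δ k : ℝ) : symbol Δ (k + Real.pi) = -symbol Δ k := by
  have h1 : Complex.exp (((k + Real.pi : ℝ) : ℂ) * Complex.I) = -Complex.exp (k * Complex.I) := by
    push_cast
    rw [add_mul, Complex.exp_add, Complex.exp_pi_mul_I]
    ring
  have h2 : Complex.exp (-(((k + Real.pi : ℝ) : ℂ) * Complex.I)) =
      -Complex.exp (-(k * Complex.I)) := by
    rw [Complex.exp_neg, h1, Complex.exp_neg, inv_neg]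
  rw [symbol, symbol, h1, h2, ← neg_mul]
  ext i j
  fin_cases i <;> fin_cases j <;> simp

/-- The quadratic forms of `1`, `U` and `U²` are combinations of the squared norms of the components
with coefficients `λ⁰, λ¹, λ²`; solving for the component with phase `ω` gives `weight`. The one with
phase `-ω` is obtained from `U(k + π) = -U(k)`. -/
theorem normSq_component_two_three {Δ : ℝ} (hp : p Δ ^ 2 < 1) (φ : Fin 4 → ℂ) (k : ℝ) :
    normSq (component Δ φ k 2) = weight Δ φ k ∧
      normSq (component Δ φ k 3) = weight Δ φ (k + Real.pi) := by
  have hs := sinOmega_pos hp k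
  have hs2 := sinOmega_sq hp k
  have h0 := sum_normSq_component hp φ k
  have h1 := star_dotProduct_symbol_pow_mulVec hp φ k 1
  have h2 := star_dotProduct_symbol_pow_mulVec hp φ k 2
  rw [Fin.sum_univ_four] at h0 h1 h2
  rw [eigenvalue_zero, eigenvalue_one, eigenvalue_two hp, eigenvalue_three hp] at h1 h2
  generalize p Δ * Real.cos k = c at hs2 h1 h2
  have h1' := congrArg Complex.im h1
  have h2' := congrArg Complex.re h2
  simp [pow_two] at h1' h2'
  have e2 : (star φ ⬝ᵥ (symbol Δ (k + Real.pi) ^ 2 *ᵥ φ)) = star φ ⬝ᵥ (symbol Δ k ^ 2 *ᵥ φ) := by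
    rw [symbol_add_pi, neg_sq]
  have e1 : (star φ ⬝ᵥ (symbol Δ (k + Real.pi) *ᵥ φ)) = -(star φ ⬝ᵥ (symbol Δ k *ᵥ φ)) := by
    rw [symbol_add_pi, Matrix.neg_mulVec, dotProduct_neg]
  unfold weight
  rw [e1, e2, sinOmega_add_pi, pow_two (symbol Δ k), h2', Complex.neg_im, h1', ← h0]
  constructor
  · rw [eq_div_iff (by positivity)]
    linear_combination (normSq (component Δ φ k 2) + normSq (component Δ φ k 3)) * hs2
  · rw [eq_div_iff (by positivity)]
    linear_combination (normSq (component Δ φ k 2) + normSq (component Δ φ k 3)) * hs2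

theorem weight_nonneg {Δ : ℝ} (hp : p Δ ^ 2 < 1) (φ : Fin 4 → ℂ) (k : ℝ) : 0 ≤ weight Δ φ k := by
  rw [← (normSq_component_two_three hp φ k).1]
  exact normSq_nonneg _

/-! ### The quadratic form of the symbol -/

theorem symbol_eq_cos_sin (Δ : ℝ) : ∃ a b : ℝ, a ^ 2 + b ^ 2 = 1 / 2 ∧ p Δ = a - b ∧
    q Δ = a + b ∧ ∀ k (z w : ℂ), z = ⟨Real.cos k, Real.sin k⟩ → w = ⟨Real.cos k, -Real.sin k⟩ →
    symbol Δ k = !![w * a, w * b, -(w * a), w * b; z * b, z * a, z * b, -(z * a);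
      w * b, -(w * a), -(w * b), -(w * a); -(z * a), z * b, -(z * a), -(z * b)] := by
  obtain ⟨a, b, ha, hb, h, hp, hq⟩ := exists_coin_entries Δ
  refine ⟨a, b, h, hp, hq, fun k z w hz hw => symbol_eq ha hb ?_ ?_⟩
  · rw [hz, Complex.exp_mul_I]
    apply Complex.ext <;> simp [Complex.cos_ofReal_re, Complex.sin_ofReal_re]
  · rw [hw, ← neg_mul, Complex.exp_mul_I]
    apply Complex.ext <;> simp [Complex.cos_ofReal_re, Complex.sin_ofReal_re]

theorem im_symbol_add (Δ k : ℝ) (φ₁ φ₂ φ₃ φ₄ : ℂ) :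
    (star ![φ₁, φ₂, φ₃, φ₄] ⬝ᵥ (symbol Δ k *ᵥ ![φ₁, φ₂, φ₃, φ₄])).im +
      (star ![φ₁, φ₂, φ₃, φ₄] ⬝ᵥ (symbol Δ (Real.pi - k) *ᵥ ![φ₁, φ₂, φ₃, φ₄])).im =
    d₁ Δ φ₁ φ₂ φ₃ φ₄ * Real.sin k := by
  obtain ⟨a, b, h, hp, hq, hU⟩ := symbol_eq_cos_sin Δ
  rw [hU k _ _ rfl rfl, hU (Real.pi - k) _ _ rfl rfl, d₁, hp, hq, Real.cos_pi_sub,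
    Real.sin_pi_sub]
  simp [dotProduct, Matrix.mulVec, Fin.sum_univ_four, Complex.sq_norm, Complex.normSq_apply]
  ring

theorem re_symbol_sq_add (Δ k : ℝ) (φ₁ φ₂ φ₃ φ₄ : ℂ) :
    2 * normSq ![φ₁, φ₂, φ₃, φ₄] -
      (star ![φ₁, φ₂, φ₃, φ₄] ⬝ᵥ (symbol Δ k ^ 2 *ᵥ ![φ₁, φ₂, φ₃, φ₄])).re -
      (star ![φ₁, φ₂, φ₃, φ₄] ⬝ᵥ (symbol Δ (Real.pi - k) ^ 2 *ᵥ ![φ₁, φ₂, φ₃, φ₄])).re =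
    2 * (1 - (p Δ * Real.cos k) ^ 2) * d₀ φ₁ φ₂ φ₃ φ₄ +
      2 * Real.sin k ^ 2 * d₂ Δ φ₁ φ₂ φ₃ φ₄ := by
  obtain ⟨a, b, h, hp, hq, hU⟩ := symbol_eq_cos_sin Δ
  rw [hU k _ _ rfl rfl, hU (Real.pi - k) _ _ rfl rfl, d₀, d₂, hp, hq, Real.cos_pi_sub,
    Real.sin_pi_sub, pow_two, pow_two, ← Matrix.mulVec_mulVec, ← Matrix.mulVec_mulVec]
  have hcs := Real.sin_sq_add_cos_sq k
  generalize Real.cos k = c at *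
  generalize Real.sin k = s at *
  obtain ⟨x1, y1⟩ := φ₁
  obtain ⟨x2, y2⟩ := φ₂
  obtain ⟨x3, y3⟩ := φ₃
  obtain ⟨x4, y4⟩ := φ₄
  simp [dotProduct, Matrix.mulVec, Fin.sum_univ_four, normSq, Complex.sq_norm, Complex.normSq_apply]
  clear hU hp hq
  have hs : s ^ 2 = 1 - c ^ 2 := by linarith
  have hb : b ^ 2 = 1 / 2 - a ^ 2 := by linarith
  ring_nf
  simp only [hs, hb]
  ring

/-- The symmetrisation `k ↦ π - k`, which fixes the group velocity, turns the weight of the phase `ω`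
into a quadratic polynomial in the velocity. -/
theorem weight_add_weight_pi_sub {Δ : ℝ} (hp : p Δ ^ 2 < 1) (hp0 : p Δ ≠ 0) (k : ℝ)
    (φ₁ φ₂ φ₃ φ₄ : ℂ) :
    weight Δ ![φ₁, φ₂, φ₃, φ₄] k + weight Δ ![φ₁, φ₂, φ₃, φ₄] (Real.pi - k) =
      (p Δ ^ 2 * d₀ φ₁ φ₂ φ₃ φ₄ + p Δ * d₁ Δ φ₁ φ₂ φ₃ φ₄ * velocity Δ k
        + d₂ Δ φ₁ φ₂ φ₃ φ₄ * velocity Δ k ^ 2) / (2 * p Δ ^ 2) := by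
  have hs := sinOmega_pos hp k
  have hs2 := sinOmega_sq hp k
  have h1 := im_symbol_add Δ k φ₁ φ₂ φ₃ φ₄
  have h2 := re_symbol_sq_add Δ k φ₁ φ₂ φ₃ φ₄
  have hs' : sinOmega Δ (Real.pi - k) = sinOmega Δ k := by simp [sinOmega]
  rw [← hs2] at h2
  simp only [weight, velocity, hs']
  field_simp
  linear_combination 4 * sinOmega Δ k * h1 + 2 * h2

/-! ### Fourier transform of finitely supported states -/

/-- The Fourier transform `∑ₓ exp (i k x) ψ(x)` of a state. -/
noncomputable def fourierState (ψ : State) (k : ℝ) : Fin 4 → ℂ :=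
  fun i => ∑' x : ℤ, Complex.exp (k * x * Complex.I) * ψ x i

theorem support_evolution_finite (Δ : ℝ) {ψ : State} (hψ : ψ.support.Finite) :
    (evolution Δ ψ).support.Finite := by
  refine ((hψ.preimage (f := fun x => x + 1) (add_left_injective 1).injOn).union
    (hψ.preimage (f := fun x => x - 1) (sub_left_injective (b := (1 : ℤ))).injOn)).subset ?_
  intro x hx
  by_contra h
  simp only [mem_union, mem_preimage, Function.mem_support, not_or, not_not] at h
  refine hx ?_
  rw [evolution_apply Δ ψ x _ _ rfl rfl, h.1, h.2]
  ext i
  fin_cases i <;> simp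

theorem support_stateAt_finite (Δ : ℝ) (φ₁ φ₂ φ₃ φ₄ : ℂ) (n : ℕ) :
    (stateAt Δ φ₁ φ₂ φ₃ φ₄ n).support.Finite := by
  induction n with
  | zero =>
    refine (finite_singleton (0 : ℤ)).subset fun x hx => ?_
    by_contra h
    have h' : x ≠ 0 := h
    exact hx (by simp [stateAt, initialState, delta, h'])
  | succ n ih =>
    rw [stateAt_succ]
    exact support_evolution_finite Δ ih

theorem fourierState_eq_sum {ψ : State} {s : Finset ℤ} (hs : ψ.support ⊆ s) (k : ℝ) (i : Fin 4) :
    fourierState ψ k i = ∑ x ∈ s, Complex.exp (k * x * Complex.I) * ψ x i := by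
  refine tsum_eq_sum fun x hx => ?_
  have : ψ x = 0 := by
    by_contra h
    exact hx (hs h)
  rw [this]
  simp

theorem hasSum_fourierState {ψ : State} (hψ : ψ.support.Finite) (k : ℝ) (i : Fin 4) :
    HasSum (fun x : ℤ => Complex.exp (k * x * Complex.I) * ψ x i) (fourierState ψ k i) := by
  refine (summable_of_ne_finset_zero (s := hψ.toFinset) fun x hx => ?_).hasSum
  have : ψ x = 0 := by
    by_contra h
    exact hx (hψ.mem_toFinset.2 h)
  rw [this]
  simp

/-- Translation of a state multiplies its Fourier transform by a phase. -/
theorem hasSum_fourierState_add {ψ : State} (hψ : ψ.support.Finite) (k : ℝ) (i : Fin 4) (a : ℤ) :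
    HasSum (fun x : ℤ => Complex.exp (k * x * Complex.I) * ψ (x + a) i)
      (Complex.exp (-(k * a * Complex.I)) * fourierState ψ k i) := by
  have h := ((Equiv.addRight a).hasSum_iff.2 (hasSum_fourierState hψ k i)).mul_left
    (Complex.exp (-(k * a * Complex.I)))
  refine h.congr_fun ?_
  intro x
  simp only [Function.comp, Equiv.coe_addRight]
  rw [← mul_assoc, ← Complex.exp_add]
  congr 2
  push_cast
  ring

theorem fourierState_evolution (Δ : ℝ) {ψ : State} (hψ : ψ.support.Finite) (k : ℝ) :
    fourierState (evolution Δ ψ) k = symbol Δ k *ᵥ fourierState ψ k := by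
  have hl := fun i => hasSum_fourierState_add hψ k i 1
  have hr := fun i => hasSum_fourierState_add hψ k i (-1)
  have e1 : Complex.exp (-(k * (1 : ℤ) * Complex.I)) = Complex.exp (-(k * Complex.I)) := by simp
  have e2 : Complex.exp (-(k * (-1 : ℤ) * Complex.I)) = Complex.exp (k * Complex.I) := by simp
  simp only [e1, e2, ← sub_eq_add_neg] at hl hr
  rw [symbol_eq rfl rfl rfl rfl]
  funext i
  rw [fourierState]
  simp only [evolution_apply Δ ψ _ _ _ rfl rfl]
  generalize ((1 / Real.sqrt 2 * Real.cos Δ : ℝ) : ℂ) = a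
  generalize ((1 / Real.sqrt 2 * Real.sin Δ : ℝ) : ℂ) = b
  fin_cases i
  · refine (HasSum.congr_fun (HasSum.add (((((hl 0).mul_left a).add ((hl 1).mul_left b)).sub ((hl 2).mul_left a)))
       ((hl 3).mul_left b)) fun x => ?_).tsum_eq.trans ?_
    · simp; ring
    · simp [Matrix.mulVec, dotProduct, Fin.sum_univ_four]; ring
  · refine (HasSum.congr_fun (HasSum.sub (((((hr 0).mul_left b).add ((hr 1).mul_left a)).add ((hr 2).mul_left b)))
       ((hr 3).mul_left a)) fun x => ?_).tsum_eq.trans ?_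
    · simp; ring
    · simp [Matrix.mulVec, dotProduct, Fin.sum_univ_four]; ring
  · refine (HasSum.congr_fun (HasSum.sub (((((hl 0).mul_left b).sub ((hl 1).mul_left a)).sub ((hl 2).mul_left b)))
       ((hl 3).mul_left a)) fun x => ?_).tsum_eq.trans ?_
    · simp; ring
    · simp [Matrix.mulVec, dotProduct, Fin.sum_univ_four]; ring
  · refine (HasSum.congr_fun (HasSum.sub (((((hr 0).mul_left (-a)).add ((hr 1).mul_left b)).sub ((hr 2).mul_left a)))
       ((hr 3).mul_left b)) fun x => ?_).tsum_eq.trans ?_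
    · simp; ring
    · simp [Matrix.mulVec, dotProduct, Fin.sum_univ_four]; ring

theorem fourierState_initialState (φ₁ φ₂ φ₃ φ₄ : ℂ) (k : ℝ) :
    fourierState (initialState φ₁ φ₂ φ₃ φ₄) k = ![φ₁, φ₂, φ₃, φ₄] := by
  funext i
  rw [fourierState, tsum_eq_single 0]
  · simp [initialState, delta]
  · intro x hx
    simp [initialState, delta, hx]

theorem fourierState_stateAt (Δ : ℝ) (φ₁ φ₂ φ₃ φ₄ : ℂ) (n : ℕ) (k : ℝ) :
    fourierState (stateAt Δ φ₁ φ₂ φ₃ φ₄ n) k = symbol Δ k ^ n *ᵥ ![φ₁, φ₂, φ₃, φ₄] := by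
  induction n with
  | zero => rw [pow_zero, Matrix.one_mulVec]; exact fourierState_initialState _ _ _ _ k
  | succ n ih =>
    rw [stateAt_succ, fourierState_evolution Δ (support_stateAt_finite _ _ _ _ _ n), ih,
      Matrix.mulVec_mulVec, pow_succ']

theorem integral_exp_int_mul (m : ℤ) :
    ∫ k in (-Real.pi)..Real.pi, Complex.exp (k * m * Complex.I) =
      if m = 0 then 2 * (Real.pi : ℂ) else 0 := by
  split_ifs with h
  · simp [h]; ring
  · have hc : (m : ℂ) * Complex.I ≠ 0 := by simp [h]
    have := integral_exp_mul_complex (a := -Real.pi) (b := Real.pi) hc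
    have e : ∀ k : ℝ, Complex.exp (k * m * Complex.I) = Complex.exp (m * Complex.I * k) :=
      fun k => by congr 1; ring
    simp only [e, this]
    have h2 : Complex.exp (m * Complex.I * (Real.pi : ℝ)) =
        Complex.exp (m * Complex.I * ((-Real.pi : ℝ) : ℂ)) := by
      rw [Complex.exp_eq_exp_iff_exists_int]
      exact ⟨m, by push_cast; ring⟩
    rw [h2, sub_self, zero_div]

/-- Parseval's identity for the overlap of the Fourier transform with its translate. -/
theorem integral_fourierState_overlap {ψ : State} {s : Finset ℤ} (hs : ψ.support ⊆ s) (η : ℝ) :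
    ∫ k in (-Real.pi)..Real.pi, star (fourierState ψ k) ⬝ᵥ fourierState ψ (k + η) =
      2 * Real.pi * ∑ x ∈ s, Complex.exp (η * x * Complex.I) * (normSq (ψ x) : ℂ) := by
  have h : ∀ k : ℝ, star (fourierState ψ k) ⬝ᵥ fourierState ψ (k + η) =
      ∑ x ∈ s, ∑ y ∈ s, Complex.exp (k * (y - x : ℤ) * Complex.I) *
        (Complex.exp (η * y * Complex.I) * (star (ψ x) ⬝ᵥ ψ y)) := by
    intro k
    simp only [dotProduct, Pi.star_apply, fourierState_eq_sum hs, star_sum, Finset.sum_mul_sum]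
    simp only [Finset.mul_sum]
    rw [Finset.sum_comm]
    refine Finset.sum_congr rfl fun x _ => ?_
    rw [Finset.sum_comm]
    refine Finset.sum_congr rfl fun y _ => Finset.sum_congr rfl fun i _ => ?_
    have e1 : star (Complex.exp (k * x * Complex.I)) = Complex.exp (-(k * x * Complex.I)) := by
      rw [Complex.star_def, ← Complex.exp_conj]; simp
    have e2 : Complex.exp (((k + η : ℝ) : ℂ) * y * Complex.I) =
        Complex.exp (k * y * Complex.I) * Complex.exp (η * y * Complex.I) := by
      rw [← Complex.exp_add]; push_cast; ring_nf
    have e3 : Complex.exp (k * (y - x : ℤ) * Complex.I) =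
        Complex.exp (-(k * x * Complex.I)) * Complex.exp (k * y * Complex.I) := by
      rw [← Complex.exp_add]; push_cast; ring_nf
    rw [star_mul', e1, e2, e3]
    ring
  simp only [h]
  rw [intervalIntegral.integral_finsetSum]
  swap
  · intro x _
    apply Continuous.intervalIntegrable
    fun_prop
  rw [Finset.mul_sum]
  refine Finset.sum_congr rfl fun x hx => ?_
  rw [intervalIntegral.integral_finsetSum]
  swap
  · intro y _
    apply Continuous.intervalIntegrable
    fun_prop
  simp only [intervalIntegral.integral_mul_const, integral_exp_int_mul]
  rw [Finset.sum_eq_single x]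
  · simp [star_dotProduct_self]
  · intro y _ hy
    rw [if_neg (sub_ne_zero.2 hy), zero_mul]
  · exact fun h => absurd hx h

/-! ### Asymptotics of the overlap -/

theorem normSq_symbol_pow_mulVec (Δ k : ℝ) (φ : Fin 4 → ℂ) (n : ℕ) :
    normSq (symbol Δ k ^ n *ᵥ φ) = normSq φ := by
  induction n with
  | zero => simp
  | succ n ih =>
    rw [← ih, pow_succ', ← Matrix.mulVec_mulVec, ← Complex.ofReal_inj, ← star_dotProduct_self,
      ← star_dotProduct_self, dotProduct_mulVec_of_unitary (symbol_unitary Δ k)]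

theorem norm_star_dotProduct_le (v w : Fin 4 → ℂ) :
    ‖star v ⬝ᵥ w‖ ≤ (normSq v + normSq w) / 2 := by
  rw [dotProduct, normSq, normSq, ← Finset.sum_add_distrib, Finset.sum_div]
  refine (norm_sum_le _ _).trans (Finset.sum_le_sum fun i _ => ?_)
  rw [norm_mul, Pi.star_apply, norm_star]
  nlinarith [sq_nonneg (‖v i‖ - ‖w i‖)]

theorem continuous_overlap (Δ η : ℝ) (φ : Fin 4 → ℂ) (n : ℕ) :
    Continuous fun k => star (symbol Δ k ^ n *ᵥ φ) ⬝ᵥ (symbol Δ (k + η) ^ n *ᵥ φ) := by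
  have h := continuous_symbol Δ
  exact Continuous.dotProduct (((h.pow n).matrix_mulVec continuous_const).star)
    (((h.comp (continuous_id.add continuous_const)).pow n).matrix_mulVec continuous_const)

theorem tendsto_nat_mul_sub {θ : ℝ → ℝ} {θ' k : ℝ} (h : HasDerivAt θ θ' k) (ξ : ℝ) :
    Tendsto (fun n : ℕ => (n : ℝ) * (θ (k + ξ / n) - θ k)) atTop (𝓝 (ξ * θ')) := by
  have h0 : HasDerivAt (fun t : ℝ => k + ξ * t) ξ 0 := by
    simpa using ((hasDerivAt_id (0 : ℝ)).const_mul ξ).const_add k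
  have h1 : HasDerivAt (fun t : ℝ => θ (k + ξ * t)) (θ' * ξ) 0 :=
    HasDerivAt.comp (0 : ℝ) (by simpa using h) h0
  have h2 : Tendsto (fun n : ℕ => (n : ℝ)⁻¹) atTop (𝓝[≠] 0) :=
    (tendsto_inv_atTop_nhdsGT_zero.comp tendsto_natCast_atTop_atTop).mono_right
      (nhdsGT_le_nhdsNE 0)
  have h3 := h1.tendsto_slope_zero.comp h2
  simpa [Function.comp_def, div_eq_mul_inv, mul_comm θ'] using h3

/-- The derivatives of the phases. -/
noncomputable def phaseVelocity (Δ k : ℝ) : Fin 4 → ℝ := ![0, 0, velocity Δ k, -velocity Δ k]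

/-- The overlap of the evolutions at the wave numbers `k` and `k + ξ / n` converges pointwise in `k`,
so that no oscillatory integral has to be estimated. -/
theorem tendsto_overlap {Δ : ℝ} (hp : p Δ ^ 2 < 1) (φ : Fin 4 → ℂ) (ξ k : ℝ) :
    Tendsto (fun n : ℕ => star (symbol Δ k ^ n *ᵥ φ) ⬝ᵥ (symbol Δ (k + ξ / n) ^ n *ᵥ φ)) atTop
      (𝓝 (∑ i, Complex.exp ((ξ * phaseVelocity Δ k i : ℝ) * Complex.I) *
        (normSq (component Δ φ k i) : ℂ))) := by
  have hexp : ∀ n : ℕ, star (symbol Δ k ^ n *ᵥ φ) ⬝ᵥ (symbol Δ (k + ξ / n) ^ n *ᵥ φ) =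
      ∑ i, ∑ j, Complex.exp ((n * (phase Δ (k + ξ / n) j - phase Δ k i) : ℝ) * Complex.I) *
        (star (component Δ φ k i) ⬝ᵥ component Δ φ (k + ξ / n) j) := by
    intro n
    rw [symbol_pow_mulVec hp, symbol_pow_mulVec hp, star_sum, sum_dotProduct]
    refine Finset.sum_congr rfl fun i _ => ?_
    rw [dotProduct_sum]
    refine Finset.sum_congr rfl fun j _ => ?_
    rw [star_smul, smul_dotProduct, dotProduct_smul, smul_smul, smul_eq_mul]
    congr 1
    rw [eigenvalue, eigenvalue, ← Complex.exp_nat_mul, ← Complex.exp_nat_mul, Complex.star_def,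
      ← Complex.exp_conj, ← Complex.exp_add]
    simp only [map_mul, Complex.conj_ofReal, Complex.conj_I, Complex.conj_natCast]
    push_cast
    ring_nf
  have hk : Tendsto (fun n : ℕ => k + ξ / n) atTop (𝓝 k) := by
    simpa using (tendsto_const_div_atTop_nhds_zero_nat ξ).const_add k
  have hcomp : ∀ i j, Tendsto (fun n : ℕ => star (component Δ φ k i) ⬝ᵥ
      component Δ φ (k + ξ / n) j) atTop
      (𝓝 (star (component Δ φ k i) ⬝ᵥ component Δ φ k j)) := by
    intro i j
    have hc : Continuous fun k' => star (component Δ φ k i) ⬝ᵥ component Δ φ k' j :=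
      Continuous.dotProduct continuous_const (continuous_component hp φ j)
    exact (hc.tendsto k).comp hk
  simp only [hexp]
  refine tendsto_finsetSum _ fun i _ => ?_
  have hlim : ∀ j, Tendsto (fun n : ℕ =>
      Complex.exp ((n * (phase Δ (k + ξ / n) j - phase Δ k i) : ℝ) * Complex.I) *
        (star (component Δ φ k i) ⬝ᵥ component Δ φ (k + ξ / n) j)) atTop
      (𝓝 (if j = i then Complex.exp ((ξ * phaseVelocity Δ k i : ℝ) * Complex.I) *
        (normSq (component Δ φ k i) : ℂ) else 0)) := by
    intro j
    split_ifs with h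
    · subst h
      rw [← star_dotProduct_self]
      refine Tendsto.mul ?_ (hcomp j j)
      have hc : Continuous fun t : ℝ => Complex.exp (t * Complex.I) := by fun_prop
      exact (hc.tendsto _).comp (tendsto_nat_mul_sub (hasDerivAt_phase hp k j) ξ)
    · -- the phase factor has modulus one and the eigenspaces are orthogonal in the limit
      have h0 := hcomp i j
      rw [component_orthogonal hp φ k (Ne.symm h), tendsto_zero_iff_norm_tendsto_zero] at h0
      rw [tendsto_zero_iff_norm_tendsto_zero]
      simpa only [norm_mul, Complex.norm_exp_ofReal_mul_I, one_mul] using h0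
  have := tendsto_finsetSum Finset.univ fun j _ => hlim j
  rwa [Finset.sum_ite_eq' Finset.univ i, if_pos (Finset.mem_univ i)] at this

theorem tendsto_integral_overlap {Δ : ℝ} (hp : p Δ ^ 2 < 1) (φ : Fin 4 → ℂ) (ξ : ℝ) :
    Tendsto (fun n : ℕ => ∫ k in (-Real.pi)..Real.pi,
      star (symbol Δ k ^ n *ᵥ φ) ⬝ᵥ (symbol Δ (k + ξ / n) ^ n *ᵥ φ)) atTop
      (𝓝 (∫ k in (-Real.pi)..Real.pi,
        ∑ i, Complex.exp ((ξ * phaseVelocity Δ k i : ℝ) * Complex.I) *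
          (normSq (component Δ φ k i) : ℂ))) := by
  refine intervalIntegral.tendsto_integral_filter_of_dominated_convergence
    (fun _ => normSq φ) (Eventually.of_forall fun n => ?_)
    (Eventually.of_forall fun n => Eventually.of_forall fun k _ => ?_)
    intervalIntegrable_const (Eventually.of_forall fun k _ => tendsto_overlap hp φ ξ k)
  · exact (continuous_overlap Δ _ φ n).aestronglyMeasurable
  · refine (norm_star_dotProduct_le _ _).trans_eq ?_
    rw [normSq_symbol_pow_mulVec, normSq_symbol_pow_mulVec, add_self_div_two]

/-! ### The limit of the characteristic functions -/

theorem continuous_sinOmega (Δ : ℝ) : Continuous (sinOmega Δ) := by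
  unfold sinOmega
  fun_prop

theorem continuous_velocity {Δ : ℝ} (hp : p Δ ^ 2 < 1) : Continuous (velocity Δ) :=
  (continuous_const.mul Real.continuous_sin).div (continuous_sinOmega Δ)
    fun k => (sinOmega_pos hp k).ne'

theorem continuous_weight {Δ : ℝ} (hp : p Δ ^ 2 < 1) (φ : Fin 4 → ℂ) :
    Continuous (weight Δ φ) := by
  have h : weight Δ φ = fun k => ∑ i, ‖component Δ φ k 2 i‖ ^ 2 :=
    funext fun k => (normSq_component_two_three hp φ k).1.symm
  rw [h]
  have hc := continuous_component hp φ 2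
  fun_prop

theorem weight_add_two_pi (Δ : ℝ) (φ : Fin 4 → ℂ) : Function.Periodic (weight Δ φ) (2 * Real.pi) := by
  intro k
  have h : k + 2 * Real.pi = k + Real.pi + Real.pi := by ring
  simp only [weight, h, symbol_add_pi, sinOmega_add_pi, neg_neg]

theorem velocity_add_pi (Δ k : ℝ) : velocity Δ (k + Real.pi) = -velocity Δ k := by
  rw [velocity, velocity, sinOmega_add_pi, Real.sin_add_pi]
  ring

theorem velocity_pi_sub (Δ k : ℝ) : velocity Δ (Real.pi - k) = velocity Δ k := by
  simp [velocity, sinOmega]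

/-- Both sides are twice the integral of `h` over a period. -/
theorem integral_add_shift_pi {h : ℝ → ℂ} (hc : Continuous h)
    (hper : Function.Periodic h (2 * Real.pi)) :
    ∫ k in (-Real.pi)..Real.pi, (h k + h (k + Real.pi)) =
      2 * ∫ k in (-(Real.pi / 2))..(Real.pi / 2), (h k + h (Real.pi - k)) := by
  have hi : ∀ a b, IntervalIntegrable h volume a b := fun a b => hc.intervalIntegrable a b
  have hc1 : Continuous fun k => h (k + Real.pi) := by fun_prop
  have hc2 : Continuous fun k => h (Real.pi - k) := by fun_prop
  rw [intervalIntegral.integral_add (hi _ _) (hc1.intervalIntegrable _ _),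
    intervalIntegral.integral_add (hi _ _) (hc2.intervalIntegrable _ _),
    intervalIntegral.integral_comp_add_right, intervalIntegral.integral_comp_sub_left]
  have e1 := hper.intervalIntegral_add_eq (-Real.pi) (-Real.pi + Real.pi)
  have e2 := hper.intervalIntegral_add_eq (-Real.pi) (-(Real.pi / 2))
  have e3 := intervalIntegral.integral_add_adjacent_intervals (hi (-(Real.pi / 2)) (Real.pi / 2))
    (hi (Real.pi / 2) (-(Real.pi / 2) + 2 * Real.pi))
  rw [show -Real.pi + 2 * Real.pi = Real.pi by ring] at e1 e2
  rw [show -Real.pi + Real.pi + 2 * Real.pi = Real.pi + Real.pi by ring] at e1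
  rw [show -(Real.pi / 2) + 2 * Real.pi = Real.pi - -(Real.pi / 2) by ring] at e2 e3
  rw [show Real.pi - Real.pi / 2 = Real.pi / 2 by ring, e3, ← e1, ← e2, two_mul]

/-- The contributions of the two non-constant phases are merged by `k ↦ k + π`; those of the constant
phases are expressed as the complement, since all squared norms add up to `normSq φ`. -/
theorem integral_limit_eq {Δ : ℝ} (hp : p Δ ^ 2 < 1) (φ : Fin 4 → ℂ) (ξ : ℝ) :
    ∫ k in (-Real.pi)..Real.pi,
        ∑ i, Complex.exp ((ξ * phaseVelocity Δ k i : ℝ) * Complex.I) *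
          (normSq (component Δ φ k i) : ℂ) =
      2 * Real.pi * normSq φ
        - 2 * (∫ k in (-(Real.pi / 2))..(Real.pi / 2),
            ((weight Δ φ k + weight Δ φ (Real.pi - k) : ℝ) : ℂ))
        + 2 * ∫ k in (-(Real.pi / 2))..(Real.pi / 2),
            Complex.exp ((ξ * velocity Δ k : ℝ) * Complex.I) *
              ((weight Δ φ k + weight Δ φ (Real.pi - k) : ℝ) : ℂ) := by
  have hw := continuous_weight hp φ
  have hv := continuous_velocity hp
  let h : ℝ → ℝ → ℂ := fun t k => Complex.exp ((t * velocity Δ k : ℝ) * Complex.I) * weight Δ φ k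
  have hc : ∀ t, Continuous (h t) := fun t => by fun_prop
  have hc' : ∀ t, Continuous fun k => h t (k + Real.pi) := fun t =>
    (hc t).comp (continuous_id.add continuous_const)
  have hper : ∀ t, Function.Periodic (h t) (2 * Real.pi) := by
    intro t k
    have e : velocity Δ (k + 2 * Real.pi) = velocity Δ k := by
      rw [show k + 2 * Real.pi = k + Real.pi + Real.pi by ring, velocity_add_pi, velocity_add_pi,
        neg_neg]
    simp only [h, e, weight_add_two_pi Δ φ k]
  have hint : ∀ k, ∑ i, Complex.exp ((ξ * phaseVelocity Δ k i : ℝ) * Complex.I) *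
      (normSq (component Δ φ k i) : ℂ) =
      normSq φ - (h 0 k + h 0 (k + Real.pi)) + (h ξ k + h ξ (k + Real.pi)) := by
    intro k
    have hs := congrArg ((↑) : ℝ → ℂ) (sum_normSq_component hp φ k)
    obtain ⟨h2, h3⟩ := normSq_component_two_three hp φ k
    rw [Fin.sum_univ_four, h2, h3] at hs
    rw [Fin.sum_univ_four, h2, h3, ← hs]
    simp [h, phaseVelocity, velocity_add_pi]
    ring
  simp only [hint]
  have ha : ∀ t, IntervalIntegrable (fun k => h t k + h t (k + Real.pi)) volume (-Real.pi)
      Real.pi := fun t => ((hc t).add (hc' t)).intervalIntegrable _ _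
  rw [intervalIntegral.integral_add (intervalIntegrable_const.sub (ha 0)) (ha ξ),
    intervalIntegral.integral_sub intervalIntegrable_const (ha 0),
    integral_add_shift_pi (hc 0) (hper 0), integral_add_shift_pi (hc ξ) (hper ξ)]
  congr 2
  · rw [intervalIntegral.integral_const, Complex.real_smul]
    push_cast
    ring
  · simp [h]
  · congr 1
    funext k
    simp only [h, velocity_pi_sub]
    push_cast
    ring

/-! ### The group velocity as a change of variables -/

theorem one_sub_velocity_sq {Δ : ℝ} (hp : p Δ ^ 2 < 1) (k : ℝ) :
    1 - velocity Δ k ^ 2 = (1 - p Δ ^ 2) / sinOmega Δ k ^ 2 := by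
  have hs := sinOmega_pos hp k
  rw [velocity, div_pow, eq_div_iff (by positivity), sub_mul, div_mul_cancel₀ _ (by positivity),
    sinOmega_sq hp]
  linear_combination (-p Δ ^ 2) * Real.sin_sq_add_cos_sq k

theorem p_sq_sub_velocity_sq {Δ : ℝ} (hp : p Δ ^ 2 < 1) (k : ℝ) :
    p Δ ^ 2 - velocity Δ k ^ 2 = (1 - p Δ ^ 2) * (p Δ * Real.cos k / sinOmega Δ k) ^ 2 := by
  have hs := sinOmega_pos hp k
  have hs2 := sinOmega_sq hp k
  rw [velocity]
  field_simp
  rw [hs2]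
  linear_combination (-p Δ ^ 2) * Real.sin_sq_add_cos_sq k

/-- The velocity determines `sin k`, which inverts the change of variables. -/
theorem p_mul_sin_eq {Δ : ℝ} (hp : p Δ ^ 2 < 1) (k : ℝ) :
    p Δ * Real.sin k =
      velocity Δ k * (Real.sqrt (1 - p Δ ^ 2) / Real.sqrt (1 - velocity Δ k ^ 2)) := by
  have hs := sinOmega_pos hp k
  have hr : 0 < Real.sqrt (1 - p Δ ^ 2) := Real.sqrt_pos.2 (sub_pos.2 hp)
  rw [one_sub_velocity_sq hp, Real.sqrt_div (sub_pos.2 hp).le, Real.sqrt_sq hs.le, velocity]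
  field_simp

theorem injOn_velocity {Δ : ℝ} (hp : p Δ ^ 2 < 1) (hp0 : p Δ ≠ 0) :
    InjOn (velocity Δ) (Ioo (-(Real.pi / 2)) (Real.pi / 2)) := by
  intro k hk k' hk' h
  have h1 := p_mul_sin_eq hp k
  rw [h, ← p_mul_sin_eq hp k'] at h1
  exact Real.injOn_sin (Ioo_subset_Icc_self hk) (Ioo_subset_Icc_self hk')
    (mul_left_cancel₀ hp0 h1)

theorem image_velocity {Δ : ℝ} (hp : p Δ ^ 2 < 1) (hp0 : p Δ ≠ 0) :
    velocity Δ '' Ioo (-(Real.pi / 2)) (Real.pi / 2) = Ioo (-|p Δ|) |p Δ| := by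
  ext y
  rw [mem_Ioo, ← abs_lt, ← sq_lt_sq]
  constructor
  · rintro ⟨k, hk, rfl⟩
    have hs := sinOmega_pos hp k
    have hc := Real.cos_pos_of_mem_Ioo hk
    rw [← sub_pos, p_sq_sub_velocity_sq hp]
    have : 0 < 1 - p Δ ^ 2 := sub_pos.2 hp
    positivity
  · intro hy
    have hy1 : 0 < 1 - y ^ 2 := by linarith
    have hr : 0 < 1 - p Δ ^ 2 := sub_pos.2 hp
    -- `t` is the sine of the preimage of `y`, read off from `p_mul_sin_eq`
    obtain ⟨t, ht⟩ : ∃ t, t = y * Real.sqrt ((1 - p Δ ^ 2) / (1 - y ^ 2)) / p Δ := ⟨_, rfl⟩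
    have ht2 : t ^ 2 = y ^ 2 * ((1 - p Δ ^ 2) / (1 - y ^ 2)) / p Δ ^ 2 := by
      rw [ht, div_pow, mul_pow, Real.sq_sqrt (by positivity)]
    have ht1 : t ^ 2 < 1 := by
      rw [ht2, div_lt_one (by positivity), ← mul_div_assoc, div_lt_iff₀ hy1]
      nlinarith
    have habs := abs_lt.1 ((sq_lt_one_iff_abs_lt_one t).1 ht1)
    refine ⟨Real.arcsin t, ⟨Real.neg_pi_div_two_lt_arcsin.2 habs.1,
      Real.arcsin_lt_pi_div_two.2 habs.2⟩, ?_⟩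
    have hs : sinOmega Δ (Real.arcsin t) = Real.sqrt ((1 - p Δ ^ 2) / (1 - y ^ 2)) := by
      rw [sinOmega, mul_pow, Real.cos_arcsin, Real.sq_sqrt (by linarith), ht2]
      congr 1
      field_simp
      ring
    have hpos : 0 < Real.sqrt ((1 - p Δ ^ 2) / (1 - y ^ 2)) := Real.sqrt_pos.2 (by positivity)
    rw [velocity, hs, Real.sin_arcsin habs.1.le habs.2.le, ht]
    field_simp

theorem hasDerivAt_velocity {Δ : ℝ} (hp : p Δ ^ 2 < 1) (k : ℝ) :
    HasDerivAt (velocity Δ) (p Δ * Real.cos k * (1 - p Δ ^ 2) / sinOmega Δ k ^ 3) k := by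
  have hs := sinOmega_pos hp k
  have hs2 := sinOmega_sq hp k
  have h1 : HasDerivAt (sinOmega Δ) (p Δ ^ 2 * Real.cos k * Real.sin k / sinOmega Δ k) k := by
    have := ((((Real.hasDerivAt_cos k).const_mul (p Δ)).pow 2).const_sub 1).sqrt
      (sub_pos.2 (p_cos_sq_lt_one hp k)).ne'
    refine this.congr_deriv ?_
    change _ / (2 * sinOmega Δ k) = _
    field_simp
    norm_num
    ring
  refine (((Real.hasDerivAt_sin k).const_mul (p Δ)).div h1 hs.ne').congr_deriv ?_
  field_simp
  rw [hs2]
  linear_combination (-p Δ ^ 3 * Real.cos k) * Real.sin_sq_add_cos_sq k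

/-- The Jacobian of the change of variables `y = v(k)` cancels the Konno density in `f`: the velocity
of a wave number uniformly distributed on `(-π/2, π/2)` has density
`√(1 - p²) / (π (1 - y²) √(p² - y²))`. -/
theorem abs_deriv_velocity_mul_f {Δ : ℝ} (hp : p Δ ^ 2 < 1) (hp0 : p Δ ≠ 0) (φ₁ φ₂ φ₃ φ₄ : ℂ)
    {k : ℝ} (hk : k ∈ Ioo (-(Real.pi / 2)) (Real.pi / 2)) :
    |p Δ * Real.cos k * (1 - p Δ ^ 2) / sinOmega Δ k ^ 3| * f Δ φ₁ φ₂ φ₃ φ₄ (velocity Δ k) =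
      Real.pi⁻¹ * (weight Δ ![φ₁, φ₂, φ₃, φ₄] k +
        weight Δ ![φ₁, φ₂, φ₃, φ₄] (Real.pi - k)) := by
  have hs := sinOmega_pos hp k
  have hc := Real.cos_pos_of_mem_Ioo hk
  have hr : 0 < 1 - p Δ ^ 2 := sub_pos.2 hp
  have hr' : 0 < Real.sqrt (1 - p Δ ^ 2) := Real.sqrt_pos.2 hr
  have hr2 := Real.sq_sqrt hr.le
  have habs : 0 < |p Δ| := abs_pos.2 hp0
  rw [weight_add_weight_pi_sub hp hp0, f, one_sub_velocity_sq hp, p_sq_sub_velocity_sq hp,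
    Real.sqrt_mul hr.le, Real.sqrt_sq_eq_abs, abs_div, abs_div, abs_mul, abs_mul,
    abs_of_pos hc, abs_of_pos hr, abs_of_pos hs, abs_of_pos (pow_pos hs 3)]
  generalize p Δ ^ 2 * d₀ φ₁ φ₂ φ₃ φ₄ + p Δ * d₁ Δ φ₁ φ₂ φ₃ φ₄ * velocity Δ k +
    d₂ Δ φ₁ φ₂ φ₃ φ₄ * velocity Δ k ^ 2 = g
  field_simp

theorem f_nonneg {Δ : ℝ} (hp : p Δ ^ 2 < 1) (hp0 : p Δ ≠ 0) (φ₁ φ₂ φ₃ φ₄ : ℂ) {y : ℝ}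
    (hy : y ∈ Ioo (-|p Δ|) |p Δ|) : 0 ≤ f Δ φ₁ φ₂ φ₃ φ₄ y := by
  rw [← image_velocity hp hp0] at hy
  obtain ⟨k, hk, rfl⟩ := hy
  have h := abs_deriv_velocity_mul_f hp hp0 φ₁ φ₂ φ₃ φ₄ hk
  have hs := sinOmega_pos hp k
  have hc := Real.cos_pos_of_mem_Ioo hk
  have hr : 0 < 1 - p Δ ^ 2 := sub_pos.2 hp
  have hpos : 0 < |p Δ * Real.cos k * (1 - p Δ ^ 2) / sinOmega Δ k ^ 3| := by
    rw [abs_pos]; positivity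
  refine nonneg_of_mul_nonneg_right (h ▸ ?_) hpos
  exact mul_nonneg (inv_nonneg.2 Real.pi_pos.le)
    (add_nonneg (weight_nonneg hp _ _) (weight_nonneg hp _ _))

theorem integrable_density {Δ : ℝ} (hp : p Δ ^ 2 < 1) (hp0 : p Δ ≠ 0) (φ₁ φ₂ φ₃ φ₄ : ℂ) :
    Integrable (density Δ φ₁ φ₂ φ₃ φ₄) := by
  rw [density, integrable_indicator_iff measurableSet_Ioo, ← image_velocity hp hp0,
    integrableOn_image_iff_integrableOn_abs_deriv_smul measurableSet_Ioo
      (fun k _ => (hasDerivAt_velocity hp k).hasDerivWithinAt) (injOn_velocity hp hp0)]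
  have hw := continuous_weight hp ![φ₁, φ₂, φ₃, φ₄]
  have hc : Continuous fun k => Real.pi⁻¹ * (weight Δ ![φ₁, φ₂, φ₃, φ₄] k +
        weight Δ ![φ₁, φ₂, φ₃, φ₄] (Real.pi - k)) := by fun_prop
  exact (hc.integrableOn_Icc.mono_set Ioo_subset_Icc_self).congr_fun
    (fun k hk => (abs_deriv_velocity_mul_f hp hp0 φ₁ φ₂ φ₃ φ₄ hk).symm) measurableSet_Ioo

theorem integral_density_mul {Δ : ℝ} (hp : p Δ ^ 2 < 1) (hp0 : p Δ ≠ 0) (φ₁ φ₂ φ₃ φ₄ : ℂ)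
    (F : ℝ → ℂ) :
    ∫ y, (density Δ φ₁ φ₂ φ₃ φ₄ y : ℂ) * F y =
      (Real.pi : ℂ)⁻¹ * ∫ k in (-(Real.pi / 2))..(Real.pi / 2), F (velocity Δ k) *
        ((weight Δ ![φ₁, φ₂, φ₃, φ₄] k + weight Δ ![φ₁, φ₂, φ₃, φ₄] (Real.pi - k) : ℝ) : ℂ) := by
  have h1 : (fun y => (density Δ φ₁ φ₂ φ₃ φ₄ y : ℂ) * F y) = (Ioo (-|p Δ|) |p Δ|).indicator
      fun y => (f Δ φ₁ φ₂ φ₃ φ₄ y : ℂ) * F y := by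
    funext y
    by_cases hy : y ∈ Ioo (-|p Δ|) |p Δ| <;> simp [density, hy]
  rw [h1, integral_indicator measurableSet_Ioo, ← image_velocity hp hp0,
    integral_image_eq_integral_abs_deriv_smul measurableSet_Ioo
      (fun k _ => (hasDerivAt_velocity hp k).hasDerivWithinAt) (injOn_velocity hp hp0),
    intervalIntegral.integral_of_le (by linarith [Real.pi_pos]), integral_Ioc_eq_integral_Ioo,
    ← integral_const_mul]
  refine setIntegral_congr_fun measurableSet_Ioo fun k hk => ?_
  have h := congrArg ((↑) : ℝ → ℂ) (abs_deriv_velocity_mul_f hp hp0 φ₁ φ₂ φ₃ φ₄ hk)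
  rw [Complex.ofReal_mul, Complex.ofReal_mul, Complex.ofReal_inv] at h
  simp only [Complex.real_smul]
  linear_combination (F (velocity Δ k)) * h

/-! ### Mass of the absolutely continuous part -/

theorem integral_velocity (Δ : ℝ) : ∫ k in (-(Real.pi / 2))..(Real.pi / 2), velocity Δ k = 0 := by
  have h := intervalIntegral.integral_comp_neg (a := -(Real.pi / 2)) (b := Real.pi / 2)
    (velocity Δ)
  have hodd : ∀ k, velocity Δ (-k) = -velocity Δ k := fun k => by
    simp [velocity, sinOmega, neg_div]
  simp only [hodd, intervalIntegral.integral_neg, neg_neg] at h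
  linarith

/-- With `r = √(1 - p²)`, the function `k + arctan ((1 - r) sin k cos k / (r cos² k + sin² k))` is
the smooth continuation of `arctan (tan k / r)` past the poles of the tangent. -/
theorem integral_inv_sinOmega_sq {Δ : ℝ} (hp : p Δ ^ 2 < 1) :
    ∫ k in (-(Real.pi / 2))..(Real.pi / 2), Real.sqrt (1 - p Δ ^ 2) / sinOmega Δ k ^ 2 =
      Real.pi := by
  have hr : 0 < Real.sqrt (1 - p Δ ^ 2) := Real.sqrt_pos.2 (sub_pos.2 hp)
  have hr2 : Real.sqrt (1 - p Δ ^ 2) ^ 2 = 1 - p Δ ^ 2 := Real.sq_sqrt (sub_pos.2 hp).le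
  have hcont : Continuous fun k => Real.sqrt (1 - p Δ ^ 2) / sinOmega Δ k ^ 2 :=
    continuous_const.div ((continuous_sinOmega Δ).pow 2) fun k =>
      pow_ne_zero 2 (sinOmega_pos hp k).ne'
  have hs2 : ∀ k, sinOmega Δ k ^ 2 =
      Real.sqrt (1 - p Δ ^ 2) ^ 2 * Real.cos k ^ 2 + Real.sin k ^ 2 := fun k => by
    rw [sinOmega_sq hp, hr2]
    linear_combination (-1 : ℝ) * Real.sin_sq_add_cos_sq k
  have hi := hcont.intervalIntegrable (μ := volume) (-(Real.pi / 2)) (Real.pi / 2)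
  simp only [hs2] at hi ⊢
  generalize Real.sqrt (1 - p Δ ^ 2) = r at *
  have hD : ∀ k, 0 < r * Real.cos k ^ 2 + Real.sin k ^ 2 := fun k => by
    rcases eq_or_ne (Real.cos k) 0 with h | h
    · have := Real.sin_sq_add_cos_sq k
      rw [h] at this ⊢
      nlinarith
    · positivity
  have hE : ∀ k, 0 < r ^ 2 * Real.cos k ^ 2 + Real.sin k ^ 2 := fun k => by
    rcases eq_or_ne (Real.cos k) 0 with h | h
    · have := Real.sin_sq_add_cos_sq k
      rw [h] at this ⊢
      nlinarith
    · positivity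
  have hderiv : ∀ k, HasDerivAt (fun k => k + Real.arctan ((1 - r) * (Real.sin k * Real.cos k) /
      (r * Real.cos k ^ 2 + Real.sin k ^ 2)))
      (r / (r ^ 2 * Real.cos k ^ 2 + Real.sin k ^ 2)) k := by
    intro k
    have hsin := Real.hasDerivAt_sin k
    have hcos := Real.hasDerivAt_cos k
    have h1 : HasDerivAt (fun k => (1 - r) * (Real.sin k * Real.cos k) /
        (r * Real.cos k ^ 2 + Real.sin k ^ 2)) _ k := ((hsin.mul hcos).const_mul (1 - r)).div (((hcos.pow 2).const_mul r).add (hsin.pow 2))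
      (hD k).ne'
    refine ((hasDerivAt_id k).add h1.arctan).congr_deriv ?_
    have hcs := Real.sin_sq_add_cos_sq k
    have hDk := (hD k).ne'
    have hEk := (hE k).ne'
    have hF : (r * Real.cos k ^ 2 + Real.sin k ^ 2) ^ 2 +
        ((1 - r) * (Real.sin k * Real.cos k)) ^ 2 =
        r ^ 2 * Real.cos k ^ 2 + Real.sin k ^ 2 := by
      linear_combination (r ^ 2 * Real.cos k ^ 2 + Real.sin k ^ 2) * hcs
    have hG : 1 + ((1 - r) * (Real.sin k * Real.cos k) /
        (r * Real.cos k ^ 2 + Real.sin k ^ 2)) ^ 2 = (r ^ 2 * Real.cos k ^ 2 + Real.sin k ^ 2) /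
        (r * Real.cos k ^ 2 + Real.sin k ^ 2) ^ 2 := by
      rw [← hF]
      field_simp
    simp only [Pi.mul_apply]
    rw [hG]
    generalize Real.sin k = s at *
    generalize Real.cos k = c at *
    field_simp
    norm_num
    linear_combination (r * (s ^ 2 + c ^ 2 + 1) - r ^ 2 * c ^ 2 - s ^ 2) * hcs
  rw [intervalIntegral.integral_eq_sub_of_hasDerivAt (fun k _ => hderiv k) hi]
  simp

theorem integral_velocity_sq {Δ : ℝ} (hp : p Δ ^ 2 < 1) :
    ∫ k in (-(Real.pi / 2))..(Real.pi / 2), velocity Δ k ^ 2 =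
      Real.pi * (1 - Real.sqrt (1 - p Δ ^ 2)) := by
  have hr2 : Real.sqrt (1 - p Δ ^ 2) ^ 2 = 1 - p Δ ^ 2 := Real.sq_sqrt (sub_pos.2 hp).le
  have hcont : Continuous fun k => Real.sqrt (1 - p Δ ^ 2) / sinOmega Δ k ^ 2 :=
    continuous_const.div ((continuous_sinOmega Δ).pow 2) fun k =>
      pow_ne_zero 2 (sinOmega_pos hp k).ne'
  have h : ∀ k, velocity Δ k ^ 2 =
      1 - Real.sqrt (1 - p Δ ^ 2) * (Real.sqrt (1 - p Δ ^ 2) / sinOmega Δ k ^ 2) := fun k => by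
    rw [← mul_div_assoc, ← pow_two, hr2, ← one_sub_velocity_sq hp]
    ring
  simp only [h]
  rw [intervalIntegral.integral_sub intervalIntegrable_const
    ((hcont.const_mul _).intervalIntegrable _ _), intervalIntegral.integral_const_mul,
    integral_inv_sinOmega_sq hp, intervalIntegral.integral_const, smul_eq_mul]
  ring

/-- The absolutely continuous part of the limit law has mass `1 - A`. -/
theorem integral_weight_add {Δ : ℝ} (hp : p Δ ^ 2 < 1) (hp0 : p Δ ≠ 0) (φ₁ φ₂ φ₃ φ₄ : ℂ) :
    ∫ k in (-(Real.pi / 2))..(Real.pi / 2), (weight Δ ![φ₁, φ₂, φ₃, φ₄] k +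
        weight Δ ![φ₁, φ₂, φ₃, φ₄] (Real.pi - k)) =
      Real.pi * (1 - atomWeight Δ φ₁ φ₂ φ₃ φ₄) := by
  have hv := continuous_velocity hp
  simp only [weight_add_weight_pi_sub hp hp0]
  rw [intervalIntegral.integral_div, intervalIntegral.integral_add, intervalIntegral.integral_add,
    intervalIntegral.integral_const, intervalIntegral.integral_const_mul,
    intervalIntegral.integral_const_mul, integral_velocity, integral_velocity_sq hp, atomWeight,
    smul_eq_mul]
  · field_simp
    ring
  all_goals
    apply Continuous.intervalIntegrable
    fun_prop

/-! ### The law of the position -/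

theorem prob_eq_normSq (Δ : ℝ) (φ₁ φ₂ φ₃ φ₄ : ℂ) (n : ℕ) (x : ℤ) :
    prob Δ φ₁ φ₂ φ₃ φ₄ n x = normSq (stateAt Δ φ₁ φ₂ φ₃ φ₄ n x) := rfl

theorem prob_eq_zero {Δ : ℝ} {φ₁ φ₂ φ₃ φ₄ : ℂ} {n : ℕ} {x : ℤ}
    (hx : x ∉ (support_stateAt_finite Δ φ₁ φ₂ φ₃ φ₄ n).toFinset) :
    prob Δ φ₁ φ₂ φ₃ φ₄ n x = 0 := by
  rw [Finite.mem_toFinset, Function.mem_support, not_not] at hx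
  simp [prob, hx]

theorem sum_exp_mul_prob (Δ : ℝ) (φ₁ φ₂ φ₃ φ₄ : ℂ) (n : ℕ) (η : ℝ) :
    ∑ x ∈ (support_stateAt_finite Δ φ₁ φ₂ φ₃ φ₄ n).toFinset,
        Complex.exp (η * x * Complex.I) * (prob Δ φ₁ φ₂ φ₃ φ₄ n x : ℂ) =
      (2 * Real.pi : ℂ)⁻¹ * ∫ k in (-Real.pi)..Real.pi,
        star (symbol Δ k ^ n *ᵥ ![φ₁, φ₂, φ₃, φ₄]) ⬝ᵥ
          (symbol Δ (k + η) ^ n *ᵥ ![φ₁, φ₂, φ₃, φ₄]) := by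
  have h := integral_fourierState_overlap (ψ := stateAt Δ φ₁ φ₂ φ₃ φ₄ n)
    (s := (support_stateAt_finite Δ φ₁ φ₂ φ₃ φ₄ n).toFinset) (Finite.coe_toFinset _).ge η
  simp only [fourierState_stateAt, ← prob_eq_normSq] at h
  have hpi : (2 * Real.pi : ℂ) ≠ 0 := by simp [Real.pi_ne_zero]
  rw [h, inv_mul_cancel_left₀ hpi]

theorem hasSum_prob (Δ : ℝ) {φ₁ φ₂ φ₃ φ₄ : ℂ}
    (hφ : ‖φ₁‖ ^ 2 + ‖φ₂‖ ^ 2 + ‖φ₃‖ ^ 2 + ‖φ₄‖ ^ 2 = 1) (n : ℕ) :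
    HasSum (prob Δ φ₁ φ₂ φ₃ φ₄ n) 1 := by
  have hN : normSq ![φ₁, φ₂, φ₃, φ₄] = 1 := by simpa [normSq, Fin.sum_univ_four] using hφ
  have h := sum_exp_mul_prob Δ φ₁ φ₂ φ₃ φ₄ n 0
  have hpi : (2 * Real.pi : ℂ) ≠ 0 := by simp [Real.pi_ne_zero]
  have h2 : (Real.pi : ℂ) + Real.pi = 2 * Real.pi := by ring
  simp only [add_zero, star_dotProduct_self, normSq_symbol_pow_mulVec, hN] at h
  simp only [Complex.ofReal_zero, zero_mul, Complex.exp_zero, one_mul, Complex.ofReal_one,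
    intervalIntegral.integral_const, sub_neg_eq_add, Complex.real_smul, Complex.ofReal_add,
    mul_one, h2, inv_mul_cancel₀ hpi] at h
  have h' : ∑ x ∈ (support_stateAt_finite Δ φ₁ φ₂ φ₃ φ₄ n).toFinset,
      prob Δ φ₁ φ₂ φ₃ φ₄ n x = 1 := by exact_mod_cast h
  rw [← h']
  exact hasSum_sum_of_ne_finset_zero fun x hx => prob_eq_zero hx

theorem charFun_map_div {Ω : Type*} [MeasurableSpace Ω] {P : Measure Ω} [IsProbabilityMeasure P]
    {X : Ω → ℤ} (hX : Measurable X) {Δ : ℝ} {φ₁ φ₂ φ₃ φ₄ : ℂ} {n : ℕ}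
    (hP : ∀ x, P.real {ω | X ω = x} = prob Δ φ₁ φ₂ φ₃ φ₄ n x) (ξ : ℝ) :
    charFun (P.map fun ω => (X ω : ℝ) / n) ξ =
      (2 * Real.pi : ℂ)⁻¹ * ∫ k in (-Real.pi)..Real.pi,
        star (symbol Δ k ^ n *ᵥ ![φ₁, φ₂, φ₃, φ₄]) ⬝ᵥ
          (symbol Δ (k + ξ / n) ^ n *ᵥ ![φ₁, φ₂, φ₃, φ₄]) := by
  have hg : Measurable fun x : ℤ => (x : ℝ) / n := measurable_from_top
  have hcomp : (P.map fun ω => (X ω : ℝ) / n) = (P.map X).map fun x : ℤ => (x : ℝ) / n :=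
    (Measure.map_map hg hX).symm
  have : IsProbabilityMeasure (P.map X) := Measure.isProbabilityMeasure_map hX.aemeasurable
  have hreal : ∀ x, (P.map X).real {x} = prob Δ φ₁ φ₂ φ₃ φ₄ n x := fun x => by
    rw [← hP x, map_measureReal_apply hX (measurableSet_singleton x)]
    rfl
  rw [hcomp, charFun_apply_real, integral_map hg.aemeasurable (by fun_prop), integral_countable,
    ← sum_exp_mul_prob, tsum_eq_sum]
  · refine Finset.sum_congr rfl fun x _ => ?_
    rw [hreal, Complex.real_smul, mul_comm]
    congr 2
    push_cast
    ring
  · intro x hx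
    rw [hreal, prob_eq_zero hx, zero_smul]
  · refine Integrable.of_bound (C := 1) measurable_from_top.aestronglyMeasurable
      (Eventually.of_forall fun x => ?_)
    rw [← Complex.ofReal_mul, Complex.norm_exp_ofReal_mul_I]

/-! ### The limit law -/

theorem p_eq_cos (Δ : ℝ) : p Δ = Real.cos (Δ + Real.pi / 4) := by
  rw [p, Real.cos_add, Real.cos_pi_div_four, Real.sin_pi_div_four, one_div,
    ← Real.sqrt_div_self]
  ring

theorem q_eq_sin (Δ : ℝ) : q Δ = Real.sin (Δ + Real.pi / 4) := by
  rw [q, Real.sin_add, Real.cos_pi_div_four, Real.sin_pi_div_four, one_div,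
    ← Real.sqrt_div_self]
  ring

theorem p_ne_zero {Δ : ℝ} (hΔ : Δ ∈ Ico (-Real.pi) Real.pi) (h1 : Δ ≠ Real.pi / 4)
    (h2 : Δ ≠ -(3 * Real.pi / 4)) : p Δ ≠ 0 := by
  rw [p_eq_cos, Ne, Real.cos_eq_zero_iff]
  rintro ⟨n, hn⟩
  have hpi := Real.pi_pos
  have hΔn : Δ = Real.pi / 4 + n * Real.pi := by linarith
  have hn1 : -2 < n := by
    have : (-2 : ℝ) < n := by nlinarith [hΔ.1]
    exact_mod_cast this
  have hn2 : n < 1 := by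
    have : (n : ℝ) < 1 := by nlinarith [hΔ.2]
    exact_mod_cast this
  obtain rfl | rfl : n = -1 ∨ n = 0 := by omega
  · exact h2 (by rw [hΔn]; push_cast; ring)
  · exact h1 (by rw [hΔn]; push_cast; ring)

theorem p_sq_lt_one {Δ : ℝ} (hΔ : Δ ∈ Ico (-Real.pi) Real.pi) (h1 : Δ ≠ -(Real.pi / 4))
    (h2 : Δ ≠ 3 * Real.pi / 4) : p Δ ^ 2 < 1 := by
  have hq : q Δ ≠ 0 := by
    rw [q_eq_sin, Ne, Real.sin_eq_zero_iff]
    rintro ⟨n, hn⟩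
    have hpi := Real.pi_pos
    have hΔn : Δ = n * Real.pi - Real.pi / 4 := by linarith
    have hn1 : -1 < n := by
      have : (-1 : ℝ) < n := by nlinarith [hΔ.1]
      exact_mod_cast this
    have hn2 : n < 2 := by
      have : (n : ℝ) < 2 := by nlinarith [hΔ.2]
      exact_mod_cast this
    obtain rfl | rfl : n = 0 ∨ n = 1 := by omega
    · exact h1 (by rw [hΔn]; push_cast; ring)
    · exact h2 (by rw [hΔn]; push_cast; ring)
  have := p_sq_add_q_sq Δ
  have : 0 < q Δ ^ 2 := by positivity
  linarith

section
variable {Δ : ℝ} {φ₁ φ₂ φ₃ φ₄ : ℂ}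

theorem atomWeight_nonneg (hp : p Δ ^ 2 < 1) (hp0 : p Δ ≠ 0)
    (hN : normSq ![φ₁, φ₂, φ₃, φ₄] = 1) : 0 ≤ atomWeight Δ φ₁ φ₂ φ₃ φ₄ := by
  -- `2π A` is the integral of the squared norm of the components with constant phase
  have hw := continuous_weight hp ![φ₁, φ₂, φ₃, φ₄]
  have h : ∫ k in (-Real.pi)..Real.pi, (weight Δ ![φ₁, φ₂, φ₃, φ₄] k +
      weight Δ ![φ₁, φ₂, φ₃, φ₄] (k + Real.pi)) =
      2 * ∫ k in (-(Real.pi / 2))..(Real.pi / 2), (weight Δ ![φ₁, φ₂, φ₃, φ₄] k +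
        weight Δ ![φ₁, φ₂, φ₃, φ₄] (Real.pi - k)) := by
    have hc : Continuous fun k => (weight Δ ![φ₁, φ₂, φ₃, φ₄] k : ℂ) := by fun_prop
    have h1 := integral_add_shift_pi hc fun k => by rw [weight_add_two_pi Δ _ k]
    simp only [← Complex.ofReal_add, intervalIntegral.integral_ofReal] at h1
    exact_mod_cast h1
  rw [integral_weight_add hp hp0] at h
  have hle : ∫ k in (-Real.pi)..Real.pi, (weight Δ ![φ₁, φ₂, φ₃, φ₄] k +
      weight Δ ![φ₁, φ₂, φ₃, φ₄] (k + Real.pi)) ≤ ∫ _k in (-Real.pi)..Real.pi, (1 : ℝ) := by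
    refine intervalIntegral.integral_mono_on (by linarith [Real.pi_pos])
      ((by fun_prop : Continuous _).intervalIntegrable _ _) intervalIntegrable_const
      fun k _ => ?_
    obtain ⟨h2, h3⟩ := normSq_component_two_three hp ![φ₁, φ₂, φ₃, φ₄] k
    have hs := sum_normSq_component hp ![φ₁, φ₂, φ₃, φ₄] k
    rw [Fin.sum_univ_four, h2, h3, hN] at hs
    linarith [normSq_nonneg (component Δ ![φ₁, φ₂, φ₃, φ₄] k 0),
      normSq_nonneg (component Δ ![φ₁, φ₂, φ₃, φ₄] k 1)]
  rw [h, intervalIntegral.integral_const, smul_eq_mul] at hle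
  have := Real.pi_pos
  nlinarith

theorem density_nonneg (hp : p Δ ^ 2 < 1) (hp0 : p Δ ≠ 0) (y : ℝ) :
    0 ≤ density Δ φ₁ φ₂ φ₃ φ₄ y :=
  indicator_nonneg (fun _ hy => f_nonneg hp hp0 φ₁ φ₂ φ₃ φ₄ hy) y

theorem limitLaw_apply (hp : p Δ ^ 2 < 1) (hp0 : p Δ ≠ 0) {s : Set ℝ} (hs : MeasurableSet s) :
    limitLaw Δ φ₁ φ₂ φ₃ φ₄ s = ENNReal.ofReal (atomWeight Δ φ₁ φ₂ φ₃ φ₄) * s.indicator 1 0 +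
      ENNReal.ofReal (∫ y in s, density Δ φ₁ φ₂ φ₃ φ₄ y) := by
  rw [limitLaw, Measure.add_apply, Measure.smul_apply, Measure.dirac_apply' _ hs, smul_eq_mul,
    withDensity_apply _ hs, ofReal_integral_eq_lintegral_ofReal
      (integrable_density hp hp0 φ₁ φ₂ φ₃ φ₄).integrableOn
      (Eventually.of_forall (density_nonneg hp hp0))]

theorem integral_density (hp : p Δ ^ 2 < 1) (hp0 : p Δ ≠ 0) :
    ∫ y, density Δ φ₁ φ₂ φ₃ φ₄ y = 1 - atomWeight Δ φ₁ φ₂ φ₃ φ₄ := by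
  have h := integral_density_mul hp hp0 φ₁ φ₂ φ₃ φ₄ fun _ => 1
  simp only [mul_one, one_mul, intervalIntegral.integral_ofReal, integral_weight_add hp hp0] at h
  rw [integral_complex_ofReal] at h
  have hpi : (Real.pi : ℂ) ≠ 0 := by simp [Real.pi_ne_zero]
  rw [Complex.ofReal_mul, inv_mul_cancel_left₀ hpi] at h
  exact_mod_cast h

theorem isProbabilityMeasure_limitLaw (hp : p Δ ^ 2 < 1) (hp0 : p Δ ≠ 0)
    (hN : normSq ![φ₁, φ₂, φ₃, φ₄] = 1) : IsProbabilityMeasure (limitLaw Δ φ₁ φ₂ φ₃ φ₄) := by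
  constructor
  have hA := atomWeight_nonneg hp hp0 hN
  have hI : 0 ≤ ∫ y, density Δ φ₁ φ₂ φ₃ φ₄ y := integral_nonneg (density_nonneg hp hp0)
  rw [limitLaw_apply hp hp0 MeasurableSet.univ, setIntegral_univ, indicator_univ, Pi.one_apply,
    mul_one, ← ENNReal.ofReal_add hA hI, integral_density hp hp0]
  simp

theorem limitLaw_real_Iic (hp : p Δ ^ 2 < 1) (hp0 : p Δ ≠ 0)
    (hN : normSq ![φ₁, φ₂, φ₃, φ₄] = 1) (x : ℝ) :
    (limitLaw Δ φ₁ φ₂ φ₃ φ₄).real (Iic x) = (if 0 ≤ x then atomWeight Δ φ₁ φ₂ φ₃ φ₄ else 0)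
      + ∫ y in Iic x, density Δ φ₁ φ₂ φ₃ φ₄ y := by
  have hA := atomWeight_nonneg hp hp0 hN
  have hI : 0 ≤ ∫ y in Iic x, density Δ φ₁ φ₂ φ₃ φ₄ y :=
    integral_nonneg (density_nonneg hp hp0)
  rw [measureReal_def, limitLaw_apply hp hp0 measurableSet_Iic]
  split_ifs with h
  · rw [indicator_of_mem (mem_Iic.2 h), Pi.one_apply, mul_one, ← ENNReal.ofReal_add hA hI,
      ENNReal.toReal_ofReal (add_nonneg hA hI)]
  · rw [indicator_of_notMem (by simpa using h), mul_zero, zero_add, zero_add,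
      ENNReal.toReal_ofReal hI]

theorem limitLaw_singleton (hp : p Δ ^ 2 < 1) (hp0 : p Δ ≠ 0) {x : ℝ}
    (hx : x ≠ 0 ∨ atomWeight Δ φ₁ φ₂ φ₃ φ₄ = 0) : limitLaw Δ φ₁ φ₂ φ₃ φ₄ {x} = 0 := by
  rw [limitLaw_apply hp hp0 (measurableSet_singleton x)]
  rcases hx with hx | hx
  · simp [hx.symm]
  · simp [hx]

theorem charFun_limitLaw (hp : p Δ ^ 2 < 1) (hp0 : p Δ ≠ 0)
    (hN : normSq ![φ₁, φ₂, φ₃, φ₄] = 1) (ξ : ℝ) :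
    charFun (limitLaw Δ φ₁ φ₂ φ₃ φ₄) ξ = (2 * Real.pi : ℂ)⁻¹ * ∫ k in (-Real.pi)..Real.pi,
        ∑ i, Complex.exp ((ξ * phaseVelocity Δ k i : ℝ) * Complex.I) *
          (normSq (component Δ ![φ₁, φ₂, φ₃, φ₄] k i) : ℂ) := by
  have hA := atomWeight_nonneg hp hp0 hN
  have := isProbabilityMeasure_limitLaw hp hp0 hN
  have hint : Integrable (fun y : ℝ => Complex.exp (ξ * y * Complex.I))
      (limitLaw Δ φ₁ φ₂ φ₃ φ₄) := by
    refine Integrable.of_bound (C := 1) (by fun_prop) (Eventually.of_forall fun x => ?_)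
    rw [← Complex.ofReal_mul, Complex.norm_exp_ofReal_mul_I]
  rw [charFun_apply_real]
  have hsplit := hint
  unfold limitLaw at hsplit ⊢
  rw [integral_add_measure hsplit.left_of_add_measure hsplit.right_of_add_measure,
    integral_smul_measure, integral_dirac, integral_withDensity_eq_integral_toReal_smul₀
      (integrable_density hp hp0 φ₁ φ₂ φ₃ φ₄).aemeasurable.ennreal_ofReal
      (Eventually.of_forall fun _ => ENNReal.ofReal_lt_top)]
  simp only [ENNReal.toReal_ofReal hA, ENNReal.toReal_ofReal (density_nonneg hp hp0 _),
    Complex.real_smul]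
  rw [integral_density_mul hp hp0, integral_limit_eq hp, intervalIntegral.integral_ofReal,
    integral_weight_add hp hp0, hN]
  have hpi : (Real.pi : ℂ) ≠ 0 := by simp [Real.pi_ne_zero]
  simp only [Complex.ofReal_mul]
  generalize (∫ k in (-(Real.pi / 2))..(Real.pi / 2),
    Complex.exp (ξ * velocity Δ k * Complex.I) * ((weight Δ ![φ₁, φ₂, φ₃, φ₄] k +
      weight Δ ![φ₁, φ₂, φ₃, φ₄] (Real.pi - k) : ℝ) : ℂ)) = J
  push_cast
  simp only [mul_zero, zero_mul, Complex.exp_zero]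
  field_simp
  ring

theorem tendstoInDistribution_limitLaw (hp : p Δ ^ 2 < 1) (hp0 : p Δ ≠ 0)
    (hN : normSq ![φ₁, φ₂, φ₃, φ₄] = 1) [IsProbabilityMeasure (limitLaw Δ φ₁ φ₂ φ₃ φ₄)]
    (Ω : ℕ → Type*) [∀ n, MeasurableSpace (Ω n)] (P : (n : ℕ) → Measure (Ω n))
    [∀ n, IsProbabilityMeasure (P n)] (X : (n : ℕ) → Ω n → ℤ) (hX : ∀ n, Measurable (X n))
    (hP : ∀ n x, (P n).real {ω | X n ω = x} = prob Δ φ₁ φ₂ φ₃ φ₄ n x) :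
    TendstoInDistribution (fun (n : ℕ) (ω : Ω n) => (X n ω : ℝ) / (n : ℝ)) atTop
      (id : ℝ → ℝ) P (limitLaw Δ φ₁ φ₂ φ₃ φ₄) where
  forall_aemeasurable n :=
    ((measurable_from_top : Measurable fun x : ℤ => (x : ℝ) / n).comp (hX n)).aemeasurable
  tendsto := by
    refine ProbabilityMeasure.tendsto_of_tendsto_charFun fun ξ => ?_
    simp only [ProbabilityMeasure.coe_mk, Measure.map_id]
    rw [charFun_limitLaw hp hp0 hN]
    simp only [charFun_map_div (hX _) (hP _)]
    exact (tendsto_integral_overlap hp _ ξ).const_mul _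

theorem tendsto_cdf (hp : p Δ ^ 2 < 1) (hp0 : p Δ ≠ 0)
    (hN : normSq ![φ₁, φ₂, φ₃, φ₄] = 1) [IsProbabilityMeasure (limitLaw Δ φ₁ φ₂ φ₃ φ₄)]
    (Ω : ℕ → Type*) [∀ n, MeasurableSpace (Ω n)] (P : (n : ℕ) → Measure (Ω n))
    [∀ n, IsProbabilityMeasure (P n)] (X : (n : ℕ) → Ω n → ℤ)
    (h : TendstoInDistribution (fun (n : ℕ) (ω : Ω n) => (X n ω : ℝ) / (n : ℝ)) atTop
      (id : ℝ → ℝ) P (limitLaw Δ φ₁ φ₂ φ₃ φ₄)) {x : ℝ}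
    (hx : x ≠ 0 ∨ atomWeight Δ φ₁ φ₂ φ₃ φ₄ = 0) :
    Tendsto (fun n : ℕ => (P n).real {ω | (X n ω : ℝ) / (n : ℝ) ≤ x}) atTop
      (𝓝 ((if 0 ≤ x then atomWeight Δ φ₁ φ₂ φ₃ φ₄ else 0)
        + ∫ y in Iic x, density Δ φ₁ φ₂ φ₃ φ₄ y)) := by
  have h1 := ProbabilityMeasure.tendsto_measure_of_null_frontier_of_tendsto' h.tendsto
    (E := Iic x) (by
      rw [frontier_Iic, ProbabilityMeasure.coe_mk, Measure.map_id]
      exact limitLaw_singleton hp hp0 hx)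
  simp only [ProbabilityMeasure.coe_mk, Measure.map_id] at h1
  have h2 := (ENNReal.tendsto_toReal (measure_ne_top _ _)).comp h1
  rw [← measureReal_def, limitLaw_real_Iic hp hp0 hN] at h2
  refine h2.congr fun n => ?_
  rw [Function.comp_apply, Measure.map_apply_of_aemeasurable (h.forall_aemeasurable n)
    measurableSet_Iic]
  rfl

end

end GroverWalk

open GroverWalk in
theorem theorem2 (φ₁ φ₂ φ₃ φ₄ : ℂ) :
    -- (A)
    (∀ Δ : ℝ, Δ ∈ Ico (-Real.pi) Real.pi →
      Δ ≠ Real.pi / 4 → Δ ≠ -(Real.pi / 4) → Δ ≠ 3 * Real.pi / 4 → Δ ≠ -(3 * Real.pi / 4) →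
      ‖φ₁‖ ^ 2 + ‖φ₂‖ ^ 2 + ‖φ₃‖ ^ 2 + ‖φ₄‖ ^ 2 = 1 →
      -- the position probabilities at each time sum to one
      (∀ n : ℕ, HasSum (prob Δ φ₁ φ₂ φ₃ φ₄ n) 1) ∧
      -- the limit law is made of a nonnegative atom and a nonnegative integrable density
      0 ≤ atomWeight Δ φ₁ φ₂ φ₃ φ₄ ∧
      (∀ y ∈ Ioo (-|p Δ|) |p Δ|, 0 ≤ f Δ φ₁ φ₂ φ₃ φ₄ y) ∧
      Integrable (density Δ φ₁ φ₂ φ₃ φ₄) ∧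
      -- weak convergence of `X_n / n`, for any random variables with the laws of the walk
      ∃ _ : IsProbabilityMeasure (limitLaw Δ φ₁ φ₂ φ₃ φ₄),
      ∀ (Ω : ℕ → Type*) [∀ n, MeasurableSpace (Ω n)] (P : (n : ℕ) → Measure (Ω n))
        [∀ n, IsProbabilityMeasure (P n)] (X : (n : ℕ) → Ω n → ℤ),
        (∀ n, Measurable (X n)) →
        (∀ n x, (P n).real {ω | X n ω = x} = prob Δ φ₁ φ₂ φ₃ φ₄ n x) →
        TendstoInDistribution (fun (n : ℕ) (ω : Ω n) => (X n ω : ℝ) / (n : ℝ)) atTop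
          (id : ℝ → ℝ) P (limitLaw Δ φ₁ φ₂ φ₃ φ₄) ∧
        -- the distribution functions converge at every continuity point of the limit
        (∀ x : ℝ, (x ≠ 0 ∨ atomWeight Δ φ₁ φ₂ φ₃ φ₄ = 0) →
          Tendsto (fun n : ℕ => (P n).real {ω | (X n ω : ℝ) / (n : ℝ) ≤ x}) atTop
            (𝓝 ((if 0 ≤ x then atomWeight Δ φ₁ φ₂ φ₃ φ₄ else 0)
              + ∫ y in Iic x, density Δ φ₁ φ₂ φ₃ φ₄ y)))) ∧
    -- (B)
    (∀ (Δ : ℝ) (j : ℕ),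
      (Δ = Real.pi / 4 ∧ j = 0) ∨ (Δ = -(3 * Real.pi / 4) ∧ j = 1) →
      ∀ (m : ℕ) (x : ℤ),
        stateAt Δ φ₁ φ₂ φ₃ φ₄ (4 * m) x = delta 0 x • ![φ₁, φ₂, φ₃, φ₄] ∧
        stateAt Δ φ₁ φ₂ φ₃ φ₄ (4 * m + 1) x =
          (((-1) ^ j / 2 : ℂ) * delta (-1) x) •
              ![φ₁ + φ₂ - φ₃ + φ₄, 0, φ₁ - φ₂ - φ₃ - φ₄, 0]
          + (((-1) ^ j / 2 : ℂ) * delta 1 x) •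
              ![0, φ₁ + φ₂ + φ₃ - φ₄, 0, -φ₁ + φ₂ - φ₃ - φ₄] ∧
        stateAt Δ φ₁ φ₂ φ₃ φ₄ (4 * m + 2) x =
          ((1 / 2 : ℂ) * delta (-2) x) • ![φ₂ + φ₄, 0, φ₂ + φ₄, 0]
          + ((1 / 2 : ℂ) * delta 0 x) • ![φ₂ - φ₄, φ₁ - φ₃, φ₄ - φ₂, φ₃ - φ₁]
          + ((1 / 2 : ℂ) * delta 2 x) • ![0, φ₁ + φ₃, 0, φ₁ + φ₃] ∧
        stateAt Δ φ₁ φ₂ φ₃ φ₄ (4 * m + 3) x =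
          (((-1) ^ j / 2 : ℂ) * delta (-1) x) •
              ![φ₂ - φ₄, φ₂ + φ₄, φ₂ - φ₄, -φ₂ - φ₄]
          + (((-1) ^ j / 2 : ℂ) * delta 1 x) •
              ![φ₁ + φ₃, φ₁ - φ₃, -φ₁ - φ₃, φ₁ - φ₃]) ∧
    -- (C)
    (∀ (Δ : ℝ) (j : ℕ),
      (Δ = -(Real.pi / 4) ∧ j = 0) ∨ (Δ = 3 * Real.pi / 4 ∧ j = 1) →
      ∀ (n m : ℕ) (x : ℤ),
        (n = 2 * m →
          stateAt Δ φ₁ φ₂ φ₃ φ₄ n x =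
            (delta (-(n : ℤ)) x / 2) • ![φ₁ - φ₃, 0, φ₃ - φ₁, 0]
            + (delta 0 x / 2) • ![φ₁ + φ₃, φ₂ + φ₄, φ₁ + φ₃, φ₂ + φ₄]
            + (delta (n : ℤ) x / 2) • ![0, φ₂ - φ₄, 0, φ₄ - φ₂]) ∧
        (n = 2 * m + 1 →
          stateAt Δ φ₁ φ₂ φ₃ φ₄ n x =
            ((-1) ^ j : ℂ) •
              ((delta (-(n : ℤ)) x / 2) • ![φ₁ - φ₃, 0, φ₃ - φ₁, 0]
              - (delta (-1) x / 2) • ![φ₂ + φ₄, 0, φ₂ + φ₄, 0]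
              - (delta 1 x / 2) • ![0, φ₁ + φ₃, 0, φ₁ + φ₃]
              + (delta (n : ℤ) x / 2) • ![0, φ₂ - φ₄, 0, φ₄ - φ₂]))) := by
  have hN : normSq ![φ₁, φ₂, φ₃, φ₄] =
      ‖φ₁‖ ^ 2 + ‖φ₂‖ ^ 2 + ‖φ₃‖ ^ 2 + ‖φ₄‖ ^ 2 := by
    simp [normSq, Fin.sum_univ_four]
  refine ⟨?_, fun Δ j h m x => stateAt_of_p_eq_zero φ₁ φ₂ φ₃ φ₄ h m x,
    fun Δ j h n m x => stateAt_of_q_eq_zero φ₁ φ₂ φ₃ φ₄ h n m x⟩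
  intro Δ hΔ h1 h2 h3 h4 hφ
  have hp := p_sq_lt_one hΔ h2 h3
  have hp0 := p_ne_zero hΔ h1 h4
  rw [← hN] at hφ
  refine ⟨hasSum_prob Δ (hN ▸ hφ), atomWeight_nonneg hp hp0 hφ,
    fun y hy => f_nonneg hp hp0 φ₁ φ₂ φ₃ φ₄ hy, integrable_density hp hp0 φ₁ φ₂ φ₃ φ₄,
    isProbabilityMeasure_limitLaw hp hp0 hφ, ?_⟩
  have := isProbabilityMeasure_limitLaw hp hp0 hφ
  intro Ω _ P _ X hX hP
  have hlim := tendstoInDistribution_limitLaw hp hp0 hφ Ω P X hX hP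
  exact ⟨hlim, fun x hx => tendsto_cdf hp hp0 hφ Ω P X hlim hx⟩
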